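/- For $0\le\alpha<1$ let $T_\alpha:[0,1]\to[0,1]$ be the Pomeau--Manneville map, $T_\alpha(x)=x(1+2^\alpha x^\alpha)$ for $x\in[0,\frac12)$ and $T_\alpha(x)=2x-1$ for $x\in[\frac12,1]$ (so $T_0$ is the doubling map). Let $m$ be Lebesgue measure on $[0,1]$, $m(f)=\int_0^1 f\,dx$, $\|f\|_1=\int_0^1|f|\,dx$, and let $\mathcal L_\alpha f(x)=\sum_{y\in T_\alpha^{-1}x} f(y)/T_\alpha'(y)$ be the transfer operator of $T_\alpha$ with respect to $m$. Let $\hat h_\alpha$ denote the density with respect to $m$ of the SRB measure of $T_\alpha$, i.e. of the $T_\alpha$-invariant Borel probability measure equivalent to $m$. For $0<\beta_*<1$ let $\mathcal C_*=\mathcal C_*(\beta_*)$ be the cone of functions $f\in C((0,1])\cap L^1$ such that $f\ge 0$, $f$ is decreasing, $x^{\beta_*+1}f(x)$ is increasing (both in the weak sense), and $f(x)\le 2^{\beta_*}(\beta_*+2)\,x^{-\beta_*}\,m(f)$ for all $x\in(0,1]$. Theorem. Let $0<\beta_*<1$. For every $\alpha\in[0,\beta_*]$ the SRB density $\hat h_\alpha$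 exists, and there is a constant $C_2=C_2(\beta_*)>0$ such that, whenever $0\le\alpha<\beta\le\beta_*$, $$\|(\mathcal L_\alpha-\mathcal L_\beta)h\|_1\le C_2\,\|h\|_1\,(\beta-\alpha)^{\frac13(1-\beta_*)}\,|\log(\beta-\alpha)|\qquad\text{for all } h\in\mathcal C_*,$$ and $$\|\hat h_\alpha-\hat h_\beta\|_1\le C_2\,(\beta-\alpha)^{\frac13(1-\beta_*)^2}\,|\log(\beta-\alpha)|^{\frac1{\beta_*}}.$$ -/

import Mathlib

open MeasureTheory Set

noncomputable section

/-- Lebesgue measure `m` on the unit interval `[0,1]`, as a measure on `ℝ`. -/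
def unitLebesgue : Measure ℝ := volume.restrict (Icc (0 : ℝ) 1)

/-- The norm `‖f‖₁` of `L¹([0,1], m)`. -/
def l1Norm (f : ℝ → ℝ) : ℝ := ∫ x, |f x| ∂unitLebesgue

/-- The Pomeau--Manneville map `T_α`; only its values on `[0,1]` matter.
For `α = 0` it is the doubling map. -/
def pmMap (α : ℝ) (x : ℝ) : ℝ :=
  if x < 1 / 2 then x * (1 + 2 ^ α * x ^ α) else 2 * x - 1

/-- The derivative `T_α'` (the right derivative, which exists also at the discontinuity `1/2`);
see `pmMap_hasDerivWithinAt`. -/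
def pmMapDeriv (α : ℝ) (x : ℝ) : ℝ :=
  if x < 1 / 2 then 1 + (1 + α) * 2 ^ α * x ^ α else 2

theorem pmMap_hasDerivWithinAt {α x : ℝ} (hα : 0 ≤ α) (hx : 0 ≤ x) :
    HasDerivWithinAt (pmMap α) (pmMapDeriv α x) (Ici x) x := by
  by_cases h : x < 1 / 2
  · have h1 : HasDerivAt (fun y : ℝ => y + 2 ^ α * y ^ (1 + α))
        (1 + 2 ^ α * ((1 + α) * x ^ (1 + α - 1))) x :=
      (hasDerivAt_id x).add
        ((Real.hasDerivAt_rpow_const (Or.inr (by linarith))).const_mul _)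
    have h2 : pmMapDeriv α x = 1 + 2 ^ α * ((1 + α) * x ^ (1 + α - 1)) := by
      rw [pmMapDeriv, if_pos h, add_sub_cancel_left]
      ring
    have key : ∀ y : ℝ, 0 ≤ y → y < 1 / 2 → pmMap α y = y + 2 ^ α * y ^ (1 + α) := by
      intro y hy hy2
      rw [pmMap, if_pos hy2, Real.rpow_add_of_nonneg hy zero_le_one hα, Real.rpow_one]
      ring
    rw [h2]
    refine h1.hasDerivWithinAt.congr_of_eventuallyEq ?_ (key x hx h)
    filter_upwards [self_mem_nhdsWithin, mem_nhdsWithin_of_mem_nhds (Iio_mem_nhds h)] with y hy hy2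
    exact key y (hx.trans hy) hy2
  · have h1 : HasDerivAt (fun y : ℝ => 2 * y - 1) 2 x := by
      simpa using ((hasDerivAt_id x).const_mul 2).sub_const 1
    rw [pmMapDeriv, if_neg h]
    have key : ∀ y : ℝ, x ≤ y → pmMap α y = 2 * y - 1 := by
      intro y hy
      rw [pmMap, if_neg (by linarith)]
    refine h1.hasDerivWithinAt.congr_of_mem (fun y hy => key y hy) ?_
    exact self_mem_Ici

/-- The transfer operator of `T_α` with respect to Lebesgue measure:
`L_α f (x) = ∑ f y / T_α' y`, over the (at most two) points `y ∈ [0,1]` with `T_α y = x`. -/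
def transferOp (α : ℝ) (f : ℝ → ℝ) (x : ℝ) : ℝ :=
  ∑ᶠ y ∈ {y : ℝ | y ∈ Icc (0 : ℝ) 1 ∧ pmMap α y = x}, f y / pmMapDeriv α y

/-- The cone `C_*(β)`, with `a(β) = 2 ^ β (β + 2)`. -/
structure MemCone (β : ℝ) (f : ℝ → ℝ) : Prop where
  continuousOn : ContinuousOn f (Ioc 0 1)
  integrable : Integrable f unitLebesgue
  nonneg : ∀ x ∈ Ioc (0 : ℝ) 1, 0 ≤ f x
  antitoneOn : AntitoneOn f (Ioc 0 1)
  monotoneOn : MonotoneOn (fun x => x ^ (β + 1) * f x) (Ioc 0 1)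
  le : ∀ x ∈ Ioc (0 : ℝ) 1,
    f x ≤ 2 ^ β * (β + 2) * x ^ (-β) * ∫ t, f t ∂unitLebesgue

/-- `μ` is an SRB measure of `T_α`: a `T_α`-invariant Borel probability measure which is
equivalent to Lebesgue measure on `[0,1]`. -/
structure IsSRBMeasure (α : ℝ) (μ : Measure ℝ) : Prop where
  prob : IsProbabilityMeasure μ
  invariant : MeasurePreserving (pmMap α) μ μ
  absolutelyContinuous : μ ≪ unitLebesgue
  absolutelyContinuous' : unitLebesgue ≪ μ

/-- `h` is (a version of) the density, with respect to Lebesgue measure on `[0,1]`, of an SRB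
measure of `T_α`. -/
structure IsSRBDensity (α : ℝ) (h : ℝ → ℝ) : Prop where
  aemeasurable : AEMeasurable h unitLebesgue
  nonneg : 0 ≤ᵐ[unitLebesgue] h
  srb : IsSRBMeasure α (unitLebesgue.withDensity fun x => ENNReal.ofReal (h x))

end

/-! Write `b = βs`, `δ = β - α` and `L_α` for the transfer operator. Both estimates follow from
stronger ones. As `δ ≤ b < 1`, the quantity `|log δ|` is at least `-log b > 0`, so the logarithmic
factors only cost a constant.

Operator estimate: raising the parameter moves left preimages to the right, so for decreasing `h`
the change of numerator in the left branch has a favourable sign. The change of derivative is of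
order `δ |log|`, integrable against `x ^ (-b)`. This bounds the difference of left parts from above;
both have the same integral, so an upper bound controls the `L¹` norm. The result is linear in `δ`
(`integral_abs_transferLin_sub_le`).

Density estimate: `L_α` preserves a cone of regular functions (`RegularCone.map_transferLin`) whose
members exceed a fixed multiple of their mass (`RegularCone.exists_lower_bound`). Hence two
densities in the cone can be coupled: a common constant is repeatedly subtracted from their
iterates, provided the remaining mass is not concentrated near the neutral fixed point. With `n + 1`
rounds of `n + 1` iterates this gives `‖L_α ^ ((n+1)²) (f - g)‖₁ ≤ D (n+1) ^ (-(1-b))`, uniformly in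
`α ≤ b` (`RegularCone.exists_decay`).

The decay makes the iterates of `1` Cauchy, which gives existence of the SRB density. By density of
polynomials it also gives convergence to every SRB density, so no cone membership of SRB densities
is needed. Telescoping `L_α ^ k - L_β ^ k` with `k = (n+1)²` yields `‖ĥ_α - ĥ_β‖₁ ≤ C (n+1)² δ + D
(n+1) ^ (-(1-b))`; with `n + 1` of order `δ ^ (-1/3)` this is `O(δ ^ ((1-b)/3))`. -/

/-! ### The left branch and its inverse. -/

/-- The left branch `y ↦ y (1 + 2 ^ α y ^ α)` of the Pomeau--Manneville map. -/
noncomputable def leftBranch (α y : ℝ) : ℝ := y * (1 + 2 ^ α * y ^ α)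

/-- The derivative of the left branch. -/
noncomputable def leftDeriv (α y : ℝ) : ℝ := 1 + (1 + α) * 2 ^ α * y ^ α

/-- The inverse of the left branch, from `(0, 1]` to `(0, 1/2]`. -/
noncomputable def leftInv (α : ℝ) (x : ℝ) : ℝ :=
  Function.invFunOn (leftBranch α) (Ioc 0 (1 / 2)) x

theorem leftBranch_strictMonoOn {α : ℝ} (hα : 0 ≤ α) :
    StrictMonoOn (leftBranch α) (Ici 0) := by
  intro x hx y hy hxy
  have hx : 0 ≤ x := hx
  have h1 : x ^ α ≤ y ^ α := Real.rpow_le_rpow hx hxy.le hα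
  have h2 : 0 ≤ x ^ α := Real.rpow_nonneg hx α
  have h3 : (0 : ℝ) < 2 ^ α := Real.rpow_pos_of_pos two_pos α
  have h4 : 2 ^ α * x ^ α ≤ 2 ^ α * y ^ α := mul_le_mul_of_nonneg_left h1 h3.le
  have h5 : 0 ≤ 2 ^ α * x ^ α := by positivity
  unfold leftBranch
  nlinarith

theorem two_rpow_mul_rpow {α y : ℝ} (hy : 0 ≤ y) : (2 : ℝ) ^ α * y ^ α = (2 * y) ^ α :=
  (Real.mul_rpow zero_le_two hy).symm

theorem leftBranch_half (α : ℝ) : leftBranch α (1 / 2) = 1 := by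
  rw [leftBranch, two_rpow_mul_rpow (by norm_num)]
  norm_num

theorem leftBranch_zero (α : ℝ) : leftBranch α 0 = 0 := by simp [leftBranch]

theorem continuous_leftBranch {α : ℝ} (hα : 0 ≤ α) : Continuous (leftBranch α) := by
  unfold leftBranch
  exact continuous_id.mul (continuous_const.add
    (continuous_const.mul (Real.continuous_rpow_const hα)))

theorem leftBranch_surjOn {α : ℝ} (hα : 0 ≤ α) :
    SurjOn (leftBranch α) (Ioc 0 (1 / 2)) (Ioc 0 1) := by
  have h := intermediate_value_Ioc (by norm_num : (0 : ℝ) ≤ 1 / 2)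
    (continuous_leftBranch hα).continuousOn
  rwa [leftBranch_half, leftBranch_zero] at h

theorem leftInv_mem {α x : ℝ} (hα : 0 ≤ α) (hx : x ∈ Ioc (0 : ℝ) 1) :
    leftInv α x ∈ Ioc (0 : ℝ) (1 / 2) :=
  Function.invFunOn_mem (leftBranch_surjOn hα hx)

theorem leftBranch_leftInv {α x : ℝ} (hα : 0 ≤ α) (hx : x ∈ Ioc (0 : ℝ) 1) :
    leftBranch α (leftInv α x) = x :=
  Function.invFunOn_eq (leftBranch_surjOn hα hx)

theorem leftBranch_mem {α y : ℝ} (hα : 0 ≤ α) (hy : y ∈ Ioc (0 : ℝ) (1 / 2)) :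
    leftBranch α y ∈ Ioc (0 : ℝ) 1 := by
  have h := leftBranch_strictMonoOn hα
  constructor
  · rw [← leftBranch_zero α]
    exact h (mem_Ici.2 le_rfl) (mem_Ici.2 hy.1.le) hy.1
  · rw [← leftBranch_half α]
    exact h.monotoneOn (mem_Ici.2 hy.1.le) (mem_Ici.2 (by norm_num)) hy.2

theorem leftInv_leftBranch {α y : ℝ} (hα : 0 ≤ α) (hy : y ∈ Ioc (0 : ℝ) (1 / 2)) :
    leftInv α (leftBranch α y) = y :=
  (leftBranch_strictMonoOn hα).injOn
    (mem_Ici.2 (leftInv_mem hα (leftBranch_mem hα hy)).1.le) (mem_Ici.2 hy.1.le)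
    (leftBranch_leftInv hα (leftBranch_mem hα hy))

theorem leftInv_one {α : ℝ} (hα : 0 ≤ α) : leftInv α 1 = 1 / 2 := by
  have h := leftInv_leftBranch hα (y := 1 / 2) (by norm_num)
  rwa [leftBranch_half] at h

theorem leftInv_strictMonoOn {α : ℝ} (hα : 0 ≤ α) : StrictMonoOn (leftInv α) (Ioc 0 1) := by
  intro x hx y hy hxy
  by_contra h
  have := (leftBranch_strictMonoOn hα).monotoneOn (mem_Ici.2 (leftInv_mem hα hy).1.le)
    (mem_Ici.2 (leftInv_mem hα hx).1.le) (not_lt.1 h)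
  rw [leftBranch_leftInv hα hx, leftBranch_leftInv hα hy] at this
  linarith

theorem leftInv_mem_Ioo {α x : ℝ} (hα : 0 ≤ α) (hx : x ∈ Ioo (0 : ℝ) 1) :
    leftInv α x ∈ Ioo (0 : ℝ) (1 / 2) := by
  have hx' := Ioo_subset_Ioc_self hx
  refine ⟨(leftInv_mem hα hx').1, ?_⟩
  rw [← leftInv_one hα]
  exact leftInv_strictMonoOn hα hx' (by norm_num) hx.2

theorem leftBranch_image_Ico {α w : ℝ} (hα : 0 ≤ α) (hw : w ∈ Ioc (0 : ℝ) 1) :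
    leftBranch α '' Ico (leftInv α w) (1 / 2) = Ico w 1 := by
  have hm := leftBranch_strictMonoOn hα
  have hw' := leftInv_mem hα hw
  ext x
  constructor
  · rintro ⟨y, hy, rfl⟩
    have hy0 : y ∈ Ici (0 : ℝ) := hw'.1.le.trans hy.1
    constructor
    · rw [← leftBranch_leftInv hα hw]
      exact hm.monotoneOn (mem_Ici.2 hw'.1.le) hy0 hy.1
    · rw [← leftBranch_half α]
      exact hm hy0 (mem_Ici.2 (by norm_num)) hy.2
  · intro hx
    have hx' : x ∈ Ioo (0 : ℝ) 1 := ⟨hw.1.trans_le hx.1, hx.2⟩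
    exact ⟨leftInv α x, ⟨(leftInv_strictMonoOn hα).monotoneOn hw (Ioo_subset_Ioc_self hx') hx.1,
      (leftInv_mem_Ioo hα hx').2⟩, leftBranch_leftInv hα (Ioo_subset_Ioc_self hx')⟩

theorem leftBranch_image_Ioo {α : ℝ} (hα : 0 ≤ α) :
    leftBranch α '' Ioo 0 (1 / 2) = Ioo 0 1 := by
  have hm := leftBranch_strictMonoOn hα
  ext x
  constructor
  · rintro ⟨y, hy, rfl⟩
    refine ⟨(leftBranch_mem hα (Ioo_subset_Ioc_self hy)).1, ?_⟩
    rw [← leftBranch_half α]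
    exact hm (mem_Ici.2 hy.1.le) (mem_Ici.2 (by norm_num)) hy.2
  · intro hx
    exact ⟨leftInv α x, leftInv_mem_Ioo hα hx, leftBranch_leftInv hα (Ioo_subset_Ioc_self hx)⟩

theorem leftBranch_hasDerivAt {α y : ℝ} (hy : 0 < y) :
    HasDerivAt (leftBranch α) (leftDeriv α y) y := by
  have h := (hasDerivAt_id y).mul
    (((Real.hasDerivAt_rpow_const (p := α) (Or.inl hy.ne')).const_mul (2 ^ α)).const_add 1)
  refine h.congr_deriv ?_
  have : y * y ^ (α - 1) = y ^ α := by
    rw [Real.rpow_sub_one hy.ne']; field_simp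
  simp only [id, leftDeriv]
  linear_combination α * 2 ^ α * this

theorem one_le_leftDeriv {α y : ℝ} (hα : 0 ≤ α) (hy : 0 ≤ y) : 1 ≤ leftDeriv α y := by
  have : 0 ≤ (1 + α) * 2 ^ α * y ^ α := by
    have := Real.rpow_nonneg hy α
    positivity
  unfold leftDeriv
  linarith

theorem leftDeriv_mono {α x y : ℝ} (hα : 0 ≤ α) (hx : 0 ≤ x) (hxy : x ≤ y) :
    leftDeriv α x ≤ leftDeriv α y := by
  have := Real.rpow_le_rpow hx hxy hα
  unfold leftDeriv
  gcongr

theorem pmMapDeriv_eq_leftDeriv {α y : ℝ} (hy : y < 1 / 2) :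
    pmMapDeriv α y = leftDeriv α y := by
  rw [pmMapDeriv, if_pos hy, leftDeriv]

theorem pmMap_eq_leftBranch {α y : ℝ} (hy : y < 1 / 2) : pmMap α y = leftBranch α y := by
  rw [pmMap, if_pos hy, leftBranch]

/-! ### The transfer operator: mass, order and contraction in `L¹`. -/

/-- The contribution of the left branch to the transfer operator. -/
noncomputable def leftPart (α : ℝ) : (ℝ → ℝ) →ₗ[ℝ] (ℝ → ℝ) where
  toFun f x := f (leftInv α x) / leftDeriv α (leftInv α x)
  map_add' f g := by ext x; simp [add_div]
  map_smul' c f := by ext x; simp [mul_div_assoc]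

/-- The contribution of the right branch to the transfer operator. -/
noncomputable def rightPart : (ℝ → ℝ) →ₗ[ℝ] (ℝ → ℝ) where
  toFun f x := f ((x + 1) / 2) / 2
  map_add' f g := by ext x; simp [add_div]
  map_smul' c f := by ext x; simp [mul_div_assoc]

/-- The transfer operator as a linear map; it is meaningful on `(0, 1)`. -/
noncomputable def transferLin (α : ℝ) : Module.End ℝ (ℝ → ℝ) := leftPart α + rightPart

theorem leftPart_apply (α : ℝ) (f : ℝ → ℝ) (x : ℝ) :
    leftPart α f x = f (leftInv α x) / leftDeriv α (leftInv α x) := rfl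

theorem rightPart_apply (f : ℝ → ℝ) (x : ℝ) : rightPart f x = f ((x + 1) / 2) / 2 := rfl

theorem transferLin_eq (α : ℝ) (f : ℝ → ℝ) :
    transferLin α f = leftPart α f + rightPart f := rfl

theorem transferLin_apply (α : ℝ) (f : ℝ → ℝ) (x : ℝ) :
    transferLin α f x = leftPart α f x + rightPart f x := rfl

/-- The endpoints form a null set and are excluded: at `x = 1` the left preimage `1/2` already
belongs to the right branch of `pmMap`, and `leftInv` says nothing at `0`. -/
theorem transferOp_eq_transferLin {α x : ℝ} (hα : 0 ≤ α) (f : ℝ → ℝ) (hx : x ∈ Ioo (0 : ℝ) 1) :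
    transferOp α f x = transferLin α f x := by
  have hy := leftInv_mem_Ioo hα hx
  have hset : {y : ℝ | y ∈ Icc (0 : ℝ) 1 ∧ pmMap α y = x} = {leftInv α x, (x + 1) / 2} := by
    ext y
    simp only [mem_ofPred_eq, mem_insert_iff, mem_singleton_iff]
    constructor
    · rintro ⟨⟨h0, h1⟩, h⟩
      by_cases hlt : y < 1 / 2
      · left
        rw [pmMap_eq_leftBranch hlt] at h
        have hy0 : 0 < y := by
          rcases h0.eq_or_lt with h0 | h0
          · rw [← h0, leftBranch_zero] at h
            exact absurd hx.1 (by rw [h]; simp)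
          · exact h0
        rw [← h, leftInv_leftBranch hα ⟨hy0, hlt.le⟩]
      · right
        rw [pmMap, if_neg hlt] at h
        linarith
    · rintro (rfl | rfl)
      · refine ⟨⟨hy.1.le, by linarith [hy.2]⟩, ?_⟩
        rw [pmMap_eq_leftBranch hy.2, leftBranch_leftInv hα (Ioo_subset_Ioc_self hx)]
      · refine ⟨⟨by linarith [hx.1], by linarith [hx.2]⟩, ?_⟩
        rw [pmMap, if_neg (by linarith [hx.1])]
        ring
  have hne : leftInv α x ≠ (x + 1) / 2 := by
    have := hy.2
    have := hx.1
    intro h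
    linarith
  rw [transferOp, hset, finsum_mem_pair hne, pmMapDeriv_eq_leftDeriv hy.2, pmMapDeriv,
    if_neg (by linarith [hx.1] : ¬ (x + 1) / 2 < 1 / 2)]
  rfl

theorem setIntegral_leftPart_image {α : ℝ} (hα : 0 ≤ α) (f : ℝ → ℝ) {s : Set ℝ}
    (hs : MeasurableSet s) (hsub : s ⊆ Ioo 0 (1 / 2)) :
    ∫ x in leftBranch α '' s, leftPart α f x = ∫ y in s, f y := by
  rw [integral_image_eq_integral_abs_deriv_smul hs
    (fun y hy => (leftBranch_hasDerivAt (hsub hy).1).hasDerivWithinAt)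
    ((leftBranch_strictMonoOn hα).injOn.mono fun y hy => (hsub hy).1.le)]
  refine setIntegral_congr_fun hs fun y hy => ?_
  have h1 := one_le_leftDeriv hα (hsub hy).1.le
  simp only [leftPart_apply, leftInv_leftBranch hα (Ioo_subset_Ioc_self (hsub hy)), smul_eq_mul]
  rw [abs_of_pos (by linarith)]
  field_simp

theorem integrableOn_leftPart {α : ℝ} (hα : 0 ≤ α) {f : ℝ → ℝ}
    (hf : IntegrableOn f (Ioo 0 (1 / 2))) : IntegrableOn (leftPart α f) (Ioo 0 1) := by
  rw [← leftBranch_image_Ioo hα, integrableOn_image_iff_integrableOn_abs_deriv_smul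
    measurableSet_Ioo (fun y hy => (leftBranch_hasDerivAt hy.1).hasDerivWithinAt)
    ((leftBranch_strictMonoOn hα).injOn.mono fun y hy => (mem_Ioo.1 hy).1.le)]
  refine hf.congr_fun (fun y hy => ?_) measurableSet_Ioo
  have h1 := one_le_leftDeriv hα hy.1.le
  simp only [leftPart_apply, leftInv_leftBranch hα (Ioo_subset_Ioc_self hy), smul_eq_mul]
  rw [abs_of_pos (by linarith)]
  field_simp

theorem image_two_mul_sub_one : (fun y : ℝ => 2 * y - 1) '' Ioo (1 / 2) 1 = Ioo 0 1 := by
  ext x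
  constructor
  · rintro ⟨y, hy, rfl⟩
    exact ⟨by linarith [hy.1], by linarith [hy.2]⟩
  · intro hx
    exact ⟨(x + 1) / 2, ⟨by linarith [hx.1], by linarith [hx.2]⟩, by ring⟩

theorem hasDerivAt_two_mul_sub_one (y : ℝ) : HasDerivAt (fun y : ℝ => 2 * y - 1) 2 y := by
  simpa using ((hasDerivAt_id y).const_mul 2).sub_const 1

theorem injective_two_mul_sub_one : Function.Injective fun y : ℝ => 2 * y - 1 := by
  intro x y h
  simp only at h
  linarith

theorem integral_rightPart (f : ℝ → ℝ) :
    ∫ x in Ioo 0 1, rightPart f x = ∫ y in Ioo (1 / 2) 1, f y := by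
  rw [← image_two_mul_sub_one, integral_image_eq_integral_abs_deriv_smul measurableSet_Ioo
    (fun y _ => (hasDerivAt_two_mul_sub_one y).hasDerivWithinAt)
    injective_two_mul_sub_one.injOn]
  refine setIntegral_congr_fun measurableSet_Ioo fun y _ => ?_
  simp only [rightPart_apply, smul_eq_mul]
  rw [show (2 * y - 1 + 1) / 2 = y by ring, abs_of_pos two_pos]
  ring

theorem integrableOn_rightPart {f : ℝ → ℝ} (hf : IntegrableOn f (Ioo (1 / 2) 1)) :
    IntegrableOn (rightPart f) (Ioo 0 1) := by
  rw [← image_two_mul_sub_one, integrableOn_image_iff_integrableOn_abs_deriv_smul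
    measurableSet_Ioo (fun y _ => (hasDerivAt_two_mul_sub_one y).hasDerivWithinAt)
    injective_two_mul_sub_one.injOn]
  refine hf.congr_fun (fun y _ => ?_) measurableSet_Ioo
  simp only [rightPart_apply, smul_eq_mul]
  rw [show (2 * y - 1 + 1) / 2 = y by ring, abs_of_pos two_pos]
  ring

theorem Ioo_left_half_subset : Ioo (0 : ℝ) (1 / 2) ⊆ Ioo 0 1 :=
  Ioo_subset_Ioo_right (by norm_num)

theorem Ioo_right_half_subset : Ioo (1 / 2 : ℝ) 1 ⊆ Ioo 0 1 :=
  Ioo_subset_Ioo_left (by norm_num)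

theorem integral_leftPart {α : ℝ} (hα : 0 ≤ α) (f : ℝ → ℝ) :
    ∫ x in Ioo 0 1, leftPart α f x = ∫ y in Ioo 0 (1 / 2), f y := by
  rw [← leftBranch_image_Ioo hα, setIntegral_leftPart_image hα f measurableSet_Ioo subset_rfl]

theorem integrableOn_transferLin {α : ℝ} (hα : 0 ≤ α) {f : ℝ → ℝ}
    (hf : IntegrableOn f (Ioo 0 1)) : IntegrableOn (transferLin α f) (Ioo 0 1) :=
  (integrableOn_leftPart hα (hf.mono_set Ioo_left_half_subset)).add
    (integrableOn_rightPart (hf.mono_set Ioo_right_half_subset))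

theorem setIntegral_Ioo_split {f : ℝ → ℝ} (hf : IntegrableOn f (Ioo 0 1)) :
    ∫ x in Ioo 0 1, f x = (∫ x in Ioo 0 (1 / 2), f x) + ∫ x in Ioo (1 / 2) 1, f x := by
  rw [← integral_Ico_eq_integral_Ioo (x := (1 / 2 : ℝ)), ← setIntegral_union _ measurableSet_Ico
    (hf.mono_set Ioo_left_half_subset), Ioo_union_Ico_eq_Ioo (by norm_num) (by norm_num)]
  · exact hf.mono_set fun x hx => ⟨by linarith [hx.1], hx.2⟩
  · exact disjoint_left.2 fun x hx hx' => absurd hx.2 (not_lt.2 hx'.1)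

theorem integral_transferLin {α : ℝ} (hα : 0 ≤ α) {f : ℝ → ℝ} (hf : IntegrableOn f (Ioo 0 1)) :
    ∫ x in Ioo 0 1, transferLin α f x = ∫ x in Ioo 0 1, f x := by
  rw [setIntegral_Ioo_split hf, ← integral_leftPart hα, ← integral_rightPart]
  exact integral_add (integrableOn_leftPart hα (hf.mono_set Ioo_left_half_subset))
    (integrableOn_rightPart (hf.mono_set Ioo_right_half_subset))

theorem half_add_one_mem {x : ℝ} (hx : x ∈ Ioo (0 : ℝ) 1) : (x + 1) / 2 ∈ Ioo (1 / 2 : ℝ) 1 :=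
  ⟨by linarith [hx.1], by linarith [hx.2]⟩

theorem transferLin_mono {α : ℝ} (hα : 0 ≤ α) {f g : ℝ → ℝ}
    (h : ∀ x ∈ Ioo (0 : ℝ) 1, f x ≤ g x) :
    ∀ x ∈ Ioo (0 : ℝ) 1, transferLin α f x ≤ transferLin α g x := by
  intro x hx
  have hy := leftInv_mem_Ioo hα hx
  have h1 := one_le_leftDeriv hα hy.1.le
  refine add_le_add ?_ ?_
  · rw [leftPart_apply, leftPart_apply]
    exact div_le_div_of_nonneg_right (h _ (Ioo_left_half_subset hy)) (by linarith)
  · rw [rightPart_apply, rightPart_apply]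
    exact div_le_div_of_nonneg_right (h _ (Ioo_right_half_subset (half_add_one_mem hx)))
      zero_le_two

theorem transferLin_pow_mono {α : ℝ} (hα : 0 ≤ α) (n : ℕ) {f g : ℝ → ℝ}
    (h : ∀ x ∈ Ioo (0 : ℝ) 1, f x ≤ g x) :
    ∀ x ∈ Ioo (0 : ℝ) 1, (transferLin α ^ n) f x ≤ (transferLin α ^ n) g x := by
  induction n with
  | zero => simpa using h
  | succ n ih =>
    rw [pow_succ']
    exact transferLin_mono hα ih

/-- The operator acts on all functions on `ℝ`, but both preimages of a point of `(0, 1)` stay in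
`(0, 1)`, so values elsewhere are irrelevant. -/
theorem transferLin_pow_congr {α : ℝ} (hα : 0 ≤ α) (n : ℕ) {f g : ℝ → ℝ}
    (h : ∀ x ∈ Ioo (0 : ℝ) 1, f x = g x) :
    ∀ x ∈ Ioo (0 : ℝ) 1, (transferLin α ^ n) f x = (transferLin α ^ n) g x := fun x hx =>
  le_antisymm (transferLin_pow_mono hα n (fun y hy => (h y hy).le) x hx)
    (transferLin_pow_mono hα n (fun y hy => (h y hy).ge) x hx)

theorem abs_transferLin_le {α : ℝ} (hα : 0 ≤ α) (f : ℝ → ℝ) :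
    ∀ x ∈ Ioo (0 : ℝ) 1, |transferLin α f x| ≤ transferLin α (fun y => |f y|) x := by
  intro x hx
  have h1 := transferLin_mono hα (f := f) (g := fun y => |f y|) (fun y _ => le_abs_self _) x hx
  have h2 := transferLin_mono hα (f := -f) (g := fun y => |f y|) (fun y _ => neg_le_abs _) x hx
  rw [map_neg] at h2
  exact abs_le'.2 ⟨h1, h2⟩

theorem integrableOn_transferLin_pow {α : ℝ} (hα : 0 ≤ α) (n : ℕ) {f : ℝ → ℝ}
    (hf : IntegrableOn f (Ioo 0 1)) : IntegrableOn ((transferLin α ^ n) f) (Ioo 0 1) := by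
  induction n with
  | zero => simpa using hf
  | succ n ih =>
    rw [pow_succ']
    exact integrableOn_transferLin hα ih

theorem integral_transferLin_pow {α : ℝ} (hα : 0 ≤ α) (n : ℕ) {f : ℝ → ℝ}
    (hf : IntegrableOn f (Ioo 0 1)) :
    ∫ x in Ioo 0 1, (transferLin α ^ n) f x = ∫ x in Ioo 0 1, f x := by
  induction n with
  | zero => simp
  | succ n ih =>
    rw [pow_succ', ← ih]
    exact integral_transferLin hα (integrableOn_transferLin_pow hα n hf)

theorem integral_abs_transferLin_le {α : ℝ} (hα : 0 ≤ α) {f : ℝ → ℝ}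
    (hf : IntegrableOn f (Ioo 0 1)) :
    ∫ x in Ioo 0 1, |transferLin α f x| ≤ ∫ x in Ioo 0 1, |f x| := by
  rw [← integral_transferLin hα hf.abs]
  exact setIntegral_mono_on (integrableOn_transferLin hα hf).abs
    (integrableOn_transferLin hα hf.abs) measurableSet_Ioo (abs_transferLin_le hα f)

theorem integral_abs_transferLin_pow_le {α : ℝ} (hα : 0 ≤ α) (n : ℕ) {f : ℝ → ℝ}
    (hf : IntegrableOn f (Ioo 0 1)) :
    ∫ x in Ioo 0 1, |(transferLin α ^ n) f x| ≤ ∫ x in Ioo 0 1, |f x| := by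
  induction n with
  | zero => simp
  | succ n ih =>
    rw [pow_succ']
    exact (integral_abs_transferLin_le hα (integrableOn_transferLin_pow hα n hf)).trans ih

/-! ### Regularity carried through one branch. -/

theorem leftBranch_eq {α y : ℝ} (hy : 0 ≤ y) : leftBranch α y = y * (1 + (2 * y) ^ α) := by
  rw [leftBranch, two_rpow_mul_rpow hy]

theorem leftDeriv_eq {α y : ℝ} (hy : 0 ≤ y) : leftDeriv α y = 1 + (1 + α) * (2 * y) ^ α := by
  rw [leftDeriv, mul_assoc, two_rpow_mul_rpow hy]

/-- With `s = (2y) ^ α` this is the factor by which the left branch multiplies `y ^ (b + 1) f(y)`.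
Writing `1 + t = (1 + s)(1 + u)`, Bernoulli's inequality reduces the claim to `(1 + α)(1 + s) ≤ (1 +
(1 + α)s)(b + 1)`, which holds because `α ≤ b`. -/
theorem rpow_one_add_div_mono {α b s t : ℝ} (hα : 0 ≤ α) (hab : α ≤ b) (hs : 0 ≤ s)
    (hst : s ≤ t) :
    (1 + s) ^ (b + 1) / (1 + (1 + α) * s) ≤ (1 + t) ^ (b + 1) / (1 + (1 + α) * t) := by
  have hs1 : 0 < 1 + s := by linarith
  have hu : 0 ≤ (t - s) / (1 + s) := div_nonneg (by linarith) hs1.le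
  have h1 : 1 + t = (1 + s) * (1 + (t - s) / (1 + s)) := by field_simp; ring
  have h2 := one_add_mul_self_le_rpow_one_add (s := (t - s) / (1 + s)) (by linarith)
    (p := b + 1) (by linarith)
  have h3 : (1 + t) ^ (b + 1) = (1 + s) ^ (b + 1) * (1 + (t - s) / (1 + s)) ^ (b + 1) := by
    conv_lhs => rw [h1]
    rw [Real.mul_rpow hs1.le (by linarith)]
  have hds : 0 < 1 + (1 + α) * s := by positivity
  have hdt : 0 < 1 + (1 + α) * t := by have := hs.trans hst; positivity
  have hp : 0 < (1 + s) ^ (b + 1) := Real.rpow_pos_of_pos hs1 _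
  have h4 : 1 + (1 + α) * t ≤ (1 + (1 + α) * s) * (1 + (b + 1) * ((t - s) / (1 + s))) := by
    have h5 : (1 + α) * (t - s) ≤ (1 + (1 + α) * s) * ((b + 1) * ((t - s) / (1 + s))) := by
      have h6 : (1 + (1 + α) * s) * ((b + 1) * ((t - s) / (1 + s)))
          = ((1 + (1 + α) * s) * (b + 1) * (t - s)) / (1 + s) := by ring
      rw [h6, le_div_iff₀ hs1]
      have h7 : (1 + α) * (1 + s) ≤ (1 + (1 + α) * s) * (b + 1) := by
        nlinarith [mul_nonneg hα hs, mul_nonneg (mul_nonneg hα hs) hα,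
          mul_nonneg (sub_nonneg.2 hab) hs, mul_nonneg (mul_nonneg (sub_nonneg.2 hab) hs) hα]
      nlinarith [mul_le_mul_of_nonneg_right h7 (sub_nonneg.2 hst)]
    nlinarith
  rw [div_le_div_iff₀ hds hdt, h3, mul_assoc]
  refine mul_le_mul_of_nonneg_left ?_ hp.le
  rw [mul_comm _ (1 + (1 + α) * s)]
  exact h4.trans (mul_le_mul_of_nonneg_left h2 hds.le)

section branches

variable {α b x y : ℝ} {f : ℝ → ℝ}

/-- The monotonicity lemmas for branches are stated for a single pair of points, so that they serve
both on `(0, 1)` and on the smaller intervals of `PiecewiseRegular`. -/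
theorem leftPart_antitone_pair (hα : 0 ≤ α) (hx : x ∈ Ioo (0 : ℝ) 1) (hy : y ∈ Ioo (0 : ℝ) 1)
    (hxy : x ≤ y) (h0 : 0 ≤ f (leftInv α x)) (h : f (leftInv α y) ≤ f (leftInv α x)) :
    leftPart α f y ≤ leftPart α f x := by
  have hx0 := (leftInv_mem_Ioo hα hx).1.le
  have h1 := one_le_leftDeriv hα hx0
  have h2 := leftDeriv_mono hα hx0 ((leftInv_strictMonoOn hα).monotoneOn
    (Ioo_subset_Ioc_self hx) (Ioo_subset_Ioc_self hy) hxy)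
  rw [leftPart_apply, leftPart_apply]
  exact div_le_div₀ h0 h (by linarith) h2

theorem rpow_mul_leftPart (hα : 0 ≤ α) (hx : x ∈ Ioo (0 : ℝ) 1) :
    x ^ (b + 1) * leftPart α f x = (leftInv α x ^ (b + 1) * f (leftInv α x)) *
      ((1 + (2 * leftInv α x) ^ α) ^ (b + 1) / (1 + (1 + α) * (2 * leftInv α x) ^ α)) := by
  have hx0 := (leftInv_mem_Ioo hα hx).1.le
  have h := leftBranch_leftInv hα (Ioo_subset_Ioc_self hx)
  rw [leftBranch_eq hx0] at h
  rw [leftPart_apply, leftDeriv_eq hx0]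
  conv_lhs => rw [← h]
  rw [Real.mul_rpow hx0 (by have := Real.rpow_nonneg (mul_nonneg zero_le_two hx0) α; linarith)]
  simp only [h]
  ring

theorem leftPart_monotone_pair (hα : 0 ≤ α) (hab : α ≤ b) (hx : x ∈ Ioo (0 : ℝ) 1)
    (hy : y ∈ Ioo (0 : ℝ) 1) (hxy : x ≤ y) (h0 : 0 ≤ f (leftInv α x))
    (h : leftInv α x ^ (b + 1) * f (leftInv α x) ≤ leftInv α y ^ (b + 1) * f (leftInv α y)) :
    x ^ (b + 1) * leftPart α f x ≤ y ^ (b + 1) * leftPart α f y := by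
  have hx0 := (leftInv_mem_Ioo hα hx).1.le
  have hm := (leftInv_strictMonoOn hα).monotoneOn
    (Ioo_subset_Ioc_self hx) (Ioo_subset_Ioc_self hy) hxy
  rw [rpow_mul_leftPart hα hx, rpow_mul_leftPart hα hy]
  have hξ : 0 ≤ (2 * leftInv α x) ^ α := Real.rpow_nonneg (by linarith) _
  refine mul_le_mul h (rpow_one_add_div_mono hα hab hξ
    (Real.rpow_le_rpow (by linarith) (by linarith) hα)) (by positivity) ?_
  exact (mul_nonneg (Real.rpow_nonneg hx0 _) h0).trans h

/-- The right branch halves the exponent of regularity. -/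
theorem rightPart_half_monotone_pair (hx : x ∈ Ioo (0 : ℝ) 1) (hy : y ∈ Ioo (0 : ℝ) 1)
    (hxy : x ≤ y) (hb : 0 ≤ b + 1) (h0 : 0 ≤ f ((y + 1) / 2))
    (h : ((x + 1) / 2) ^ (b + 1) * f ((x + 1) / 2) ≤
      ((y + 1) / 2) ^ (b + 1) * f ((y + 1) / 2)) :
    rightPart f x ≤ (y / x) ^ ((b + 1) / 2) * rightPart f y := by
  have hx1 : (0 : ℝ) < (x + 1) / 2 := by linarith [hx.1]
  have hy1 : (0 : ℝ) < (y + 1) / 2 := by linarith [hy.1]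
  -- Equivalent to `(y - x)(1 - xy) ≥ 0`.
  have hr : ((y + 1) / 2 / ((x + 1) / 2)) ^ (2 : ℝ) ≤ y / x := by
    rw [div_div_div_cancel_right₀ two_ne_zero, Real.rpow_two, div_pow,
      div_le_div_iff₀ (by have := hx.1; positivity) hx.1]
    have h5 : x * y ≤ 1 := by nlinarith [hx.1, hx.2, hy.1, hy.2]
    nlinarith [mul_nonneg (sub_nonneg.2 hxy) (sub_nonneg.2 h5)]
  have h1 : f ((x + 1) / 2) ≤ ((y + 1) / 2 / ((x + 1) / 2)) ^ (b + 1) * f ((y + 1) / 2) := by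
    rw [Real.div_rpow hy1.le hx1.le, div_mul_eq_mul_div,
      le_div_iff₀ (Real.rpow_pos_of_pos hx1 _), mul_comm]
    exact h
  have h2 : ((y + 1) / 2 / ((x + 1) / 2)) ^ (b + 1) ≤ (y / x) ^ ((b + 1) / 2) := by
    calc ((y + 1) / 2 / ((x + 1) / 2)) ^ (b + 1)
        = (((y + 1) / 2 / ((x + 1) / 2)) ^ (2 : ℝ)) ^ ((b + 1) / 2) := by
          rw [← Real.rpow_mul (by positivity)]
          congr 1
          ring
      _ ≤ _ := Real.rpow_le_rpow (by positivity) hr (by linarith)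
  rw [rightPart_apply, rightPart_apply, ← mul_div_assoc]
  exact div_le_div_of_nonneg_right (h1.trans (mul_le_mul_of_nonneg_right h2 h0)) zero_le_two

/-- Subtracting a constant that is at most half of the function doubles the exponent of
regularity. -/
theorem rpow_mul_sub_le_of_half {u v t : ℝ} (hx : 0 < x) (hxy : x ≤ y) (hb : 0 ≤ b + 1)
    (ht : 0 ≤ t) (hv : 2 * t ≤ v) (h : u ≤ (y / x) ^ ((b + 1) / 2) * v) :
    x ^ (b + 1) * (u - t) ≤ y ^ (b + 1) * (v - t) := by
  have hy : 0 < y := hx.trans_le hxy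
  set r := (y / x) ^ ((b + 1) / 2) with hr
  have hr1 : 1 ≤ r := Real.one_le_rpow ((one_le_div hx).2 hxy) (by linarith)
  have hr2 : y ^ (b + 1) = x ^ (b + 1) * r ^ 2 := by
    have h3 : r ^ 2 = (y / x) ^ (b + 1) := by
      rw [hr, ← Real.rpow_natCast, ← Real.rpow_mul (by positivity)]
      congr 1
      push_cast
      ring
    rw [h3, Real.div_rpow hy.le hx.le]
    have := (Real.rpow_pos_of_pos hx (b + 1)).ne'
    field_simp
  rw [hr2, mul_assoc]
  refine mul_le_mul_of_nonneg_left ?_ (Real.rpow_nonneg hx.le _)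
  -- Uses `r + 1 ≤ 2r`. After cancelling `x ^ (b + 1)`, the claim follows from `r²(v - t) - (rv - t)
  -- = (r - 1)(rv - (r + 1)t) ≥ 0`.
  have h4 : (r + 1) * t ≤ r * v := by nlinarith
  nlinarith [mul_nonneg (sub_nonneg.2 hr1) (sub_nonneg.2 h4)]

theorem rightPart_monotone_pair (hx : x ∈ Ioo (0 : ℝ) 1) (hy : y ∈ Ioo (0 : ℝ) 1)
    (hxy : x ≤ y) (hb : 0 ≤ b + 1) (h0 : 0 ≤ f ((y + 1) / 2))
    (h : ((x + 1) / 2) ^ (b + 1) * f ((x + 1) / 2) ≤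
      ((y + 1) / 2) ^ (b + 1) * f ((y + 1) / 2)) :
    x ^ (b + 1) * rightPart f x ≤ y ^ (b + 1) * rightPart f y := by
  have h1 := rpow_mul_sub_le_of_half hx.1 hxy hb le_rfl
    (by rw [rightPart_apply]; linarith) (rightPart_half_monotone_pair hx hy hxy hb h0 h)
  simpa using h1

end branches

/-! ### The invariant cone. -/

/-- The cone of nonnegative decreasing functions `f` on `(0, 1)` such that `x ^ (b + 1) f` is
increasing and `f ≤ A x ^ (-b) ∫ f`. -/
structure RegularCone (b A : ℝ) (f : ℝ → ℝ) : Prop where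
  integrableOn : IntegrableOn f (Ioo 0 1)
  nonneg : ∀ x ∈ Ioo (0 : ℝ) 1, 0 ≤ f x
  antitoneOn : AntitoneOn f (Ioo 0 1)
  monotoneOn : MonotoneOn (fun x => x ^ (b + 1) * f x) (Ioo 0 1)
  le : ∀ x ∈ Ioo (0 : ℝ) 1, f x ≤ A * x ^ (-b) * ∫ t in Ioo 0 1, f t

theorem RegularCone.integral_nonneg {b A : ℝ} {f : ℝ → ℝ} (hf : RegularCone b A f) :
    0 ≤ ∫ t in Ioo 0 1, f t :=
  setIntegral_nonneg measurableSet_Ioo hf.nonneg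

theorem RegularCone.mul_le_integral {b A x : ℝ} {f : ℝ → ℝ} (hf : RegularCone b A f)
    (hx : x ∈ Ioo (0 : ℝ) 1) : x * f x ≤ ∫ t in Ioo 0 1, f t := by
  have hsub : Ioo 0 x ⊆ Ioo 0 1 := Ioo_subset_Ioo_right hx.2.le
  calc x * f x = ∫ _ in Ioo 0 x, f x := by
        rw [setIntegral_const, Real.volume_real_Ioo_of_le hx.1.le]; simp
    _ ≤ ∫ t in Ioo 0 x, f t := setIntegral_mono_on (integrableOn_const (by simp))
        (hf.integrableOn.mono_set hsub) measurableSet_Ioo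
        fun t ht => hf.antitoneOn (hsub ht) hx ht.2.le
    _ ≤ _ := setIntegral_mono_set hf.integrableOn
        ((ae_restrict_iff' measurableSet_Ioo).2 (ae_of_all _ hf.nonneg)) hsub.eventuallyLE

/-- Only the pointwise bound needs balancing. With `m` the mass of `f`, `y` the left preimage of `x`
and `ξ = (2y) ^ α`, the left branch contributes at most `A x ^ (-b) m (1 + bξ) / (1 + (1 + α)ξ)`, a
gain of order `(1 + α - b)ξ`. The right branch contributes at most `m ≤ x ^ (-b) ξ m`, because `x ^
b ≤ ξ`. The gain pays for it once `A(1 - b) ≥ 3`, since `1 + (1 + α)ξ ≤ 3`. -/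
theorem RegularCone.map_transferLin {α b A : ℝ} {f : ℝ → ℝ} (hf : RegularCone b A f)
    (hα : 0 ≤ α) (hab : α ≤ b) (hb : b < 1) (hA : 3 ≤ A * (1 - b)) :
    RegularCone b A (transferLin α f) where
  integrableOn := integrableOn_transferLin hα hf.integrableOn
  nonneg x hx := by
    simpa using transferLin_mono hα (f := 0) (g := f) hf.nonneg x hx
  antitoneOn x hx y hy hxy := by
    refine add_le_add ?_ ?_
    · have hx' := Ioo_left_half_subset (leftInv_mem_Ioo hα hx)
      exact leftPart_antitone_pair hα hx hy hxy (hf.nonneg _ hx') (hf.antitoneOn hx'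
        (Ioo_left_half_subset (leftInv_mem_Ioo hα hy)) ((leftInv_strictMonoOn hα).monotoneOn
        (Ioo_subset_Ioc_self hx) (Ioo_subset_Ioc_self hy) hxy))
    · rw [rightPart_apply, rightPart_apply]
      have := hf.antitoneOn (Ioo_right_half_subset (half_add_one_mem hx))
        (Ioo_right_half_subset (half_add_one_mem hy)) (by linarith)
      linarith
  monotoneOn x hx y hy hxy := by
    simp only [transferLin_apply, mul_add]
    refine add_le_add ?_ ?_
    · have hx' := Ioo_left_half_subset (leftInv_mem_Ioo hα hx)
      exact leftPart_monotone_pair hα hab hx hy hxy (hf.nonneg _ hx') (hf.monotoneOn hx'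
        (Ioo_left_half_subset (leftInv_mem_Ioo hα hy)) ((leftInv_strictMonoOn hα).monotoneOn
        (Ioo_subset_Ioc_self hx) (Ioo_subset_Ioc_self hy) hxy))
    · have hy' := Ioo_right_half_subset (half_add_one_mem hy)
      exact rightPart_monotone_pair hx hy hxy (by linarith) (hf.nonneg _ hy')
        (hf.monotoneOn (Ioo_right_half_subset (half_add_one_mem hx)) hy' (by linarith))
  le x hx := by
    rw [integral_transferLin hα hf.integrableOn]
    have hm := hf.integral_nonneg
    set m := ∫ t in Ioo 0 1, f t
    have hy := leftInv_mem_Ioo hα hx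
    have hx1 := leftBranch_leftInv hα (Ioo_subset_Ioc_self hx)
    rw [transferLin_apply, leftPart_apply, rightPart_apply]
    set y := leftInv α x
    rw [leftBranch_eq hy.1.le] at hx1
    rw [leftDeriv_eq hy.1.le]
    have h1 := hf.le y (Ioo_left_half_subset hy)
    have h2 := hf.mul_le_integral (Ioo_right_half_subset (half_add_one_mem hx))
    have h2y : 0 < 2 * y := by linarith [hy.1]
    have hξ0 : 0 ≤ (2 * y) ^ α := Real.rpow_nonneg h2y.le α
    have hξ1 : (2 * y) ^ α ≤ 1 := Real.rpow_le_one h2y.le (by linarith [hy.2]) hα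
    have hxξ : x ^ b ≤ (2 * y) ^ α := by
      have h3 : x ≤ 2 * y := by
        rw [← hx1]
        nlinarith [hy.1]
      exact (Real.rpow_le_rpow hx.1.le h3 (hα.trans hab)).trans
        (Real.rpow_le_rpow_of_exponent_ge h2y (by linarith [hy.2]) hab)
    set ξ := (2 * y) ^ α
    have hyb : y ^ (-b) ≤ x ^ (-b) * (1 + b * ξ) := by
      have h4 : (1 + ξ) ^ b ≤ 1 + b * ξ :=
        rpow_one_add_le_one_add_mul_self (by linarith) (hα.trans hab) hb.le
      have h5 : y ^ (-b) = x ^ (-b) * (1 + ξ) ^ b := by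
        rw [← hx1, Real.mul_rpow hy.1.le (by linarith), mul_assoc, ← Real.rpow_add (by linarith)]
        simp
      rw [h5]
      exact mul_le_mul_of_nonneg_left h4 (Real.rpow_nonneg hx.1.le _)
    have hxb : 0 < x ^ (-b) := Real.rpow_pos_of_pos hx.1 _
    have hone : 1 ≤ x ^ (-b) * ξ := by
      have h6 : x ^ (-b) * x ^ b = 1 := by rw [← Real.rpow_add hx.1]; simp
      rw [← h6]
      exact mul_le_mul_of_nonneg_left hxξ hxb.le
    have hb0 : 0 ≤ b := hα.trans hab
    have hA0 : 0 ≤ A := by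
      by_contra h
      nlinarith
    have hd : 0 < 1 + (1 + α) * ξ := by positivity
    have hL : f y / (1 + (1 + α) * ξ) ≤ A * (x ^ (-b) * (1 + b * ξ)) * m / (1 + (1 + α) * ξ) := by
      refine div_le_div_of_nonneg_right (h1.trans ?_) hd.le
      gcongr
    have hR : f ((x + 1) / 2) / 2 ≤ (x ^ (-b) * ξ) * m := by
      have h7 : f ((x + 1) / 2) / 2 ≤ m := by
        have h8 := hf.nonneg _ (Ioo_right_half_subset (half_add_one_mem hx))
        nlinarith [hx.1]
      nlinarith
    refine (add_le_add hL hR).trans ?_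
    have hkey : A * (1 + b * ξ) / (1 + (1 + α) * ξ) + ξ ≤ A := by
      rw [div_add' _ _ _ hd.ne', div_le_iff₀ hd]
      have h9 : 1 + (1 + α) * ξ ≤ 3 := by nlinarith
      have h10 : (1 + (1 + α) * ξ) ≤ A * (1 + α - b) := by nlinarith
      nlinarith
    calc A * (x ^ (-b) * (1 + b * ξ)) * m / (1 + (1 + α) * ξ) + x ^ (-b) * ξ * m
        = x ^ (-b) * m * (A * (1 + b * ξ) / (1 + (1 + α) * ξ) + ξ) := by ring
      _ ≤ x ^ (-b) * m * A := mul_le_mul_of_nonneg_left hkey (by positivity)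
      _ = A * x ^ (-b) * m := by ring

/-! ### Preimages accumulating at the neutral fixed point, and piecewise regularity. -/

/-- The successive preimages of `1` under the left branch. -/
noncomputable def leftPreimage (α : ℝ) : ℕ → ℝ
  | 0 => 1
  | k + 1 => leftInv α (leftPreimage α k)

theorem leftPreimage_mem {α : ℝ} (hα : 0 ≤ α) (k : ℕ) : leftPreimage α k ∈ Ioc (0 : ℝ) 1 := by
  induction k with
  | zero => simp [leftPreimage]
  | succ k ih =>
    have h := leftInv_mem hα ih
    exact ⟨h.1, h.2.trans (by norm_num)⟩

theorem leftPreimage_succ_le_half {α : ℝ} (hα : 0 ≤ α) (k : ℕ) :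
    leftPreimage α (k + 1) ≤ 1 / 2 :=
  (leftInv_mem hα (leftPreimage_mem hα k)).2

theorem leftPreimage_one {α : ℝ} (hα : 0 ≤ α) : leftPreimage α 1 = 1 / 2 := leftInv_one hα

/-- Comparison with the slowest case `α = 1`: `y(1 + 2y) ≤ T_α y`, and `1/(k+2)` satisfies the
reverse inequality `(k+4)/(k+2)² ≥ 1/(k+1)`. The bound is uniform in `α`. -/
theorem leftPreimage_le {α : ℝ} (hα : 0 ≤ α) (hα1 : α ≤ 1) (k : ℕ) :
    leftPreimage α k ≤ 1 / (k + 1) := by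
  induction k with
  | zero => simp [leftPreimage]
  | succ k ih =>
    have hm := leftPreimage_mem hα k
    have hy : leftPreimage α (k + 1) ∈ Ioc (0 : ℝ) (1 / 2) := leftInv_mem hα hm
    have hx : leftBranch α (leftPreimage α (k + 1)) = leftPreimage α k :=
      leftBranch_leftInv hα hm
    set y := leftPreimage α (k + 1)
    rw [leftBranch_eq hy.1.le] at hx
    have h1 : 2 * y ≤ (2 * y) ^ α := by
      have := Real.rpow_le_rpow_of_exponent_ge (by linarith [hy.1] : 0 < 2 * y)
        (by linarith [hy.2]) hα1
      rwa [Real.rpow_one] at this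
    have h2 : y * (1 + 2 * y) ≤ 1 / (k + 1) := by
      refine le_trans ?_ ih
      rw [← hx]
      exact mul_le_mul_of_nonneg_left (by linarith) hy.1.le
    by_contra h
    rw [not_le] at h
    push_cast at h
    have hk : (0 : ℝ) ≤ k := Nat.cast_nonneg k
    have h3 : 1 / ((k : ℝ) + 1) ≤ 1 / (k + 1 + 1) * (1 + 2 * (1 / (k + 1 + 1))) := by
      have : 1 / ((k : ℝ) + 1 + 1) * (1 + 2 * (1 / (k + 1 + 1))) = (k + 4) / (k + 2) ^ 2 := by
        field_simp
        ring
      rw [this, div_le_div_iff₀ (by positivity) (by positivity)]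
      nlinarith
    have h4 : (0 : ℝ) < 1 / (k + 1 + 1) := by positivity
    nlinarith

theorem Ico_leftPreimage_subset {α : ℝ} (hα : 0 ≤ α) (k : ℕ) :
    Ico (leftPreimage α (k + 1)) (leftPreimage α k) ⊆ Ioo 0 1 := fun _ hx =>
  ⟨(leftPreimage_mem hα (k + 1)).1.trans_le hx.1, hx.2.trans_le (leftPreimage_mem hα k).2⟩

theorem leftInv_mem_Ico_leftPreimage {α x : ℝ} (hα : 0 ≤ α) {k : ℕ}
    (hx : x ∈ Ico (leftPreimage α (k + 1)) (leftPreimage α k)) :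
    leftInv α x ∈ Ico (leftPreimage α (k + 1 + 1)) (leftPreimage α (k + 1)) := by
  have hx' := Ioo_subset_Ioc_self (Ico_leftPreimage_subset hα k hx)
  exact ⟨(leftInv_strictMonoOn hα).monotoneOn (leftPreimage_mem hα _) hx' hx.1,
    leftInv_strictMonoOn hα hx' (leftPreimage_mem hα _) hx.2⟩

/-- Nonnegative integrable functions `f` such that on each interval between consecutive preimages
of `1` under the left branch, `f` is decreasing and `x ^ (b + 1) f` is increasing. -/
structure PiecewiseRegular (α b : ℝ) (f : ℝ → ℝ) : Prop where
  integrableOn : IntegrableOn f (Ioo 0 1)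
  nonneg : ∀ x ∈ Ioo (0 : ℝ) 1, 0 ≤ f x
  antitoneOn : ∀ k, AntitoneOn f (Ico (leftPreimage α (k + 1)) (leftPreimage α k))
  monotoneOn : ∀ k, MonotoneOn (fun x => x ^ (b + 1) * f x)
    (Ico (leftPreimage α (k + 1)) (leftPreimage α k))

/-- The coupling works in the weaker class because subtracting a constant lowers the mass and may
spoil the bound `RegularCone.le`; that bound is replaced by domination by iterates that stay in the
cone. -/
theorem RegularCone.piecewiseRegular {α b A : ℝ} {f : ℝ → ℝ} (hf : RegularCone b A f)
    (hα : 0 ≤ α) : PiecewiseRegular α b f where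
  integrableOn := hf.integrableOn
  nonneg := hf.nonneg
  antitoneOn k := hf.antitoneOn.mono (Ico_leftPreimage_subset hα k)
  monotoneOn k := hf.monotoneOn.mono (Ico_leftPreimage_subset hα k)

section piecewise

variable {α b A : ℝ} {f : ℝ → ℝ}

theorem half_add_one_mem_Ico {x : ℝ} (hα : 0 ≤ α) (hx : x ∈ Ioo (0 : ℝ) 1) :
    (x + 1) / 2 ∈ Ico (leftPreimage α (0 + 1)) (leftPreimage α 0) := by
  rw [zero_add, leftPreimage_one hα]
  exact Ioo_subset_Ico_self (half_add_one_mem hx)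

theorem PiecewiseRegular.map_leftPart (hf : PiecewiseRegular α b f) (hα : 0 ≤ α) (hab : α ≤ b) :
    PiecewiseRegular α b (leftPart α f) where
  integrableOn := integrableOn_leftPart hα (hf.integrableOn.mono_set Ioo_left_half_subset)
  nonneg x hx := by
    have hy := leftInv_mem_Ioo hα hx
    have h1 := one_le_leftDeriv hα hy.1.le
    rw [leftPart_apply]
    exact div_nonneg (hf.nonneg _ (Ioo_left_half_subset hy)) (by linarith)
  antitoneOn k x hx y hy hxy := by
    have hx1 := Ico_leftPreimage_subset hα k hx
    have hy1 := Ico_leftPreimage_subset hα k hy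
    exact leftPart_antitone_pair hα hx1 hy1 hxy
      (hf.nonneg _ (Ioo_left_half_subset (leftInv_mem_Ioo hα hx1)))
      (hf.antitoneOn (k + 1) (leftInv_mem_Ico_leftPreimage hα hx)
        (leftInv_mem_Ico_leftPreimage hα hy) ((leftInv_strictMonoOn hα).monotoneOn
        (Ioo_subset_Ioc_self hx1) (Ioo_subset_Ioc_self hy1) hxy))
  monotoneOn k x hx y hy hxy := by
    have hx1 := Ico_leftPreimage_subset hα k hx
    have hy1 := Ico_leftPreimage_subset hα k hy
    exact leftPart_monotone_pair hα hab hx1 hy1 hxy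
      (hf.nonneg _ (Ioo_left_half_subset (leftInv_mem_Ioo hα hx1)))
      (hf.monotoneOn (k + 1) (leftInv_mem_Ico_leftPreimage hα hx)
        (leftInv_mem_Ico_leftPreimage hα hy) ((leftInv_strictMonoOn hα).monotoneOn
        (Ioo_subset_Ioc_self hx1) (Ioo_subset_Ioc_self hy1) hxy))

/-- The constant is taken entirely from the right part. That part is at least `2s` and satisfies the
growth condition with exponent `(b + 1)/2`, so removing `s`, at most half of it, brings the exponent
back to no more than `b + 1`. -/
theorem PiecewiseRegular.transferLin_sub_const (hf : PiecewiseRegular α b f) (hα : 0 ≤ α)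
    (hab : α ≤ b) {s : ℝ} (hs : 0 ≤ s) (hfs : ∀ x ∈ Ioo (0 : ℝ) 1, 4 * s ≤ f x) :
    PiecewiseRegular α b (transferLin α f - fun _ => s) where
  integrableOn := (integrableOn_transferLin hα hf.integrableOn).sub
    (integrableOn_const (by simp))
  nonneg x hx := by
    have h1 := (hf.map_leftPart hα hab).nonneg x hx
    have h2 := hfs _ (Ioo_right_half_subset (half_add_one_mem hx))
    rw [Pi.sub_apply, transferLin_apply, rightPart_apply]
    linarith
  antitoneOn k x hx y hy hxy := by
    have h1 := (hf.map_leftPart hα hab).antitoneOn k hx hy hxy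
    have h2 := hf.antitoneOn 0
      (half_add_one_mem_Ico hα (Ico_leftPreimage_subset hα k hx))
      (half_add_one_mem_Ico hα (Ico_leftPreimage_subset hα k hy)) (by linarith)
    rw [Pi.sub_apply, Pi.sub_apply, transferLin_apply, transferLin_apply, rightPart_apply,
      rightPart_apply]
    linarith
  monotoneOn k x hx y hy hxy := by
    have hx1 := Ico_leftPreimage_subset hα k hx
    have hy1 := Ico_leftPreimage_subset hα k hy
    have h1 := (hf.map_leftPart hα hab).monotoneOn k hx hy hxy
    have hfy := hfs _ (Ioo_right_half_subset (half_add_one_mem hy1))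
    have h2 := rightPart_half_monotone_pair hx1 hy1 hxy (by linarith) (by linarith)
      (hf.monotoneOn 0 (half_add_one_mem_Ico hα hx1) (half_add_one_mem_Ico hα hy1) (by linarith))
    have h3 := rpow_mul_sub_le_of_half hx1.1 hxy (by linarith : 0 ≤ b + 1) hs
      (by rw [rightPart_apply]; linarith) h2
    simp only [Pi.sub_apply, transferLin_apply, add_sub_assoc] at h1 ⊢
    rw [mul_add, mul_add]
    exact add_le_add h1 h3

theorem PiecewiseRegular.map_transferLin (hf : PiecewiseRegular α b f) (hα : 0 ≤ α)
    (hab : α ≤ b) : PiecewiseRegular α b (transferLin α f) := by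
  have h := hf.transferLin_sub_const hα hab le_rfl (by simpa using hf.nonneg)
  rwa [show (fun _ : ℝ => (0 : ℝ)) = 0 from rfl, sub_zero] at h

theorem PiecewiseRegular.transferLin_pow (hf : PiecewiseRegular α b f) (hα : 0 ≤ α)
    (hab : α ≤ b) (n : ℕ) : PiecewiseRegular α b ((transferLin α ^ n) f) := by
  induction n with
  | zero => simpa using hf
  | succ n ih =>
    rw [pow_succ']
    exact ih.map_transferLin hα hab

theorem RegularCone.transferLin_pow (hf : RegularCone b A f) (hα : 0 ≤ α)
    (hab : α ≤ b) (hb : b < 1) (hA : 3 ≤ A * (1 - b)) (n : ℕ) :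
    RegularCone b A ((transferLin α ^ n) f) := by
  induction n with
  | zero => simpa using hf
  | succ n ih =>
    rw [pow_succ']
    exact ih.map_transferLin hα hab hb hA

/-- The right branch reads `f` only on `[1/2, 1)`, where `f` lies between `f(1/2)/4` and `f(1/2)`.
Hence `rightPart f ≤ f(1/2)/2`, while its mass is at least `f(1/2)/8`; this is where `A ≥ 4` comes
from. -/
theorem PiecewiseRegular.map_rightPart (hf : PiecewiseRegular α b f) (hα : 0 ≤ α) (hb0 : 0 ≤ b)
    (hb : b ≤ 1) (hA : 4 ≤ A) : RegularCone b A (rightPart f) where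
  integrableOn := integrableOn_rightPart (hf.integrableOn.mono_set Ioo_right_half_subset)
  nonneg x hx := by
    have := hf.nonneg _ (Ioo_right_half_subset (half_add_one_mem hx))
    rw [rightPart_apply]
    linarith
  antitoneOn x hx y hy hxy := by
    have := hf.antitoneOn 0 (half_add_one_mem_Ico hα hx) (half_add_one_mem_Ico hα hy)
      (by linarith)
    rw [rightPart_apply, rightPart_apply]
    linarith
  monotoneOn x hx y hy hxy :=
    rightPart_monotone_pair hx hy hxy (by linarith)
      (hf.nonneg _ (Ioo_right_half_subset (half_add_one_mem hy)))
      (hf.monotoneOn 0 (half_add_one_mem_Ico hα hx) (half_add_one_mem_Ico hα hy) (by linarith))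
  le x hx := by
    have hhalf : (1 / 2 : ℝ) ∈ Ico (leftPreimage α (0 + 1)) (leftPreimage α 0) := by
      rw [zero_add, leftPreimage_one hα]
      norm_num [leftPreimage]
    have hsub : ∀ y ∈ Ioo (1 / 2 : ℝ) 1,
        y ∈ Ico (leftPreimage α (0 + 1)) (leftPreimage α 0) := by
      rw [zero_add, leftPreimage_one hα]
      exact fun y hy => Ioo_subset_Ico_self hy
    have h0 : 0 ≤ f (1 / 2) := hf.nonneg _ (by norm_num)
    have hlow : ∀ y ∈ Ioo (1 / 2 : ℝ) 1, f (1 / 2) / 4 ≤ f y := by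
      intro y hy
      have h1 := hf.monotoneOn 0 hhalf (hsub y hy) hy.1.le
      have h2 : y ^ (b + 1) ≤ 1 := Real.rpow_le_one (by linarith [hy.1]) hy.2.le (by linarith)
      have h3 : (1 / 4 : ℝ) ≤ (1 / 2) ^ (b + 1) := by
        have := Real.rpow_le_rpow_of_exponent_ge (by norm_num : (0 : ℝ) < 1 / 2) (by norm_num)
          (by linarith : b + 1 ≤ 2)
        refine le_trans ?_ this
        norm_num
      have h4 := hf.nonneg y (Ioo_right_half_subset hy)
      simp only at h1
      nlinarith
    have hint : f (1 / 2) / 8 ≤ ∫ t in Ioo 0 1, rightPart f t := by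
      rw [integral_rightPart]
      calc f (1 / 2) / 8 = ∫ _ in Ioo (1 / 2 : ℝ) 1, f (1 / 2) / 4 := by
            rw [setIntegral_const, Real.volume_real_Ioo_of_le (by norm_num), smul_eq_mul]
            ring
        _ ≤ _ := setIntegral_mono_on (integrableOn_const (by simp))
            (hf.integrableOn.mono_set Ioo_right_half_subset) measurableSet_Ioo hlow
    have hup : f ((x + 1) / 2) ≤ f (1 / 2) :=
      hf.antitoneOn 0 hhalf (half_add_one_mem_Ico hα hx) (half_add_one_mem hx).1.le
    have hxb : 1 ≤ x ^ (-b) :=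
      Real.one_le_rpow_of_pos_of_le_one_of_nonpos hx.1 hx.2.le (by linarith)
    set m := ∫ t in Ioo 0 1, rightPart f t
    have hm : 0 ≤ m := by linarith
    rw [rightPart_apply]
    have h5 : 4 ≤ A * x ^ (-b) := by nlinarith
    nlinarith

/-! ### Lower bounds, uniform in the parameter. -/

theorem setIntegral_rpow_neg {b w : ℝ} (hb : b < 1) (hw : 0 ≤ w) :
    IntegrableOn (fun x : ℝ => x ^ (-b)) (Ioo 0 w) ∧
      ∫ x in Ioo 0 w, x ^ (-b) = w ^ (1 - b) / (1 - b) := by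
  have h1 : -1 < -b := by linarith
  constructor
  · have := intervalIntegral.intervalIntegrable_rpow' (a := 0) (b := w) h1
    rw [intervalIntegrable_iff_integrableOn_Ioo_of_le hw] at this
    exact this
  · rw [← integral_Ioc_eq_integral_Ioo, ← intervalIntegral.integral_of_le hw,
      integral_rpow (Or.inl h1), neg_add_eq_sub, Real.zero_rpow (by linarith), sub_zero]

theorem RegularCone.setIntegral_Ioo_le (hf : RegularCone b A f) (hb : b < 1) {w : ℝ}
    (hw : w ∈ Icc (0 : ℝ) 1) :
    ∫ x in Ioo 0 w, f x ≤ A * (w ^ (1 - b) / (1 - b)) * ∫ x in Ioo 0 1, f x := by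
  have hsub : Ioo 0 w ⊆ Ioo 0 1 := Ioo_subset_Ioo_right hw.2
  obtain ⟨h1, h2⟩ := setIntegral_rpow_neg hb hw.1
  calc ∫ x in Ioo 0 w, f x ≤ ∫ x in Ioo 0 w, A * x ^ (-b) * ∫ x in Ioo 0 1, f x :=
        setIntegral_mono_on (hf.integrableOn.mono_set hsub) ((h1.const_mul _).mul_const _)
          measurableSet_Ioo fun x hx => hf.le x (hsub hx)
    _ = _ := by rw [integral_mul_const, integral_const_mul, h2]

/-- The point `w` solves `A w ^ (1 - b) / (1 - b) = 1/2`, so at least half of the mass lies on `[w,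
1)` and `f(w) ≥ m/2` since `f` decreases. Left of `w` use monotonicity of `f`, right of it that of
`x ^ (b + 1) f`. -/
theorem RegularCone.exists_lower_bound (hb0 : 0 ≤ b) (hb : b < 1) (hA : 1 ≤ A) :
    ∃ c : ℝ, 0 < c ∧ c ≤ 1 ∧ ∀ f : ℝ → ℝ, RegularCone b A f →
      ∀ x ∈ Ioo (0 : ℝ) 1, c * ∫ t in Ioo 0 1, f t ≤ f x := by
  have hb1 : 0 < 1 - b := by linarith
  set w : ℝ := ((1 - b) / (2 * A)) ^ (1 / (1 - b)) with hw
  have hq0 : 0 < (1 - b) / (2 * A) := by positivity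
  have hq1 : (1 - b) / (2 * A) < 1 := by
    rw [div_lt_one (by positivity)]
    linarith
  have hw0 : 0 < w := Real.rpow_pos_of_pos hq0 _
  have hw1 : w < 1 := Real.rpow_lt_one hq0.le hq1 (by positivity)
  have hwb : w ^ (1 - b) = (1 - b) / (2 * A) := by
    rw [hw, ← Real.rpow_mul hq0.le, one_div_mul_cancel hb1.ne', Real.rpow_one]
  have hwp0 : 0 < w ^ (b + 1) := Real.rpow_pos_of_pos hw0 _
  have hwp1 : w ^ (b + 1) ≤ 1 := Real.rpow_le_one hw0.le hw1.le (by linarith)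
  refine ⟨w ^ (b + 1) / 2, by positivity, by linarith, fun f hf x hx => ?_⟩
  have hm := hf.integral_nonneg
  have htail := hf.setIntegral_Ioo_le hb ⟨hw0.le, hw1.le⟩
  have hwI : w ∈ Ioo (0 : ℝ) 1 := ⟨hw0, hw1⟩
  have hsplit : ∫ t in Ioo 0 1, f t = (∫ t in Ioo 0 w, f t) + ∫ t in Ico w 1, f t := by
    rw [← setIntegral_union _ measurableSet_Ico
      (hf.integrableOn.mono_set (Ioo_subset_Ioo_right hw1.le)), Ioo_union_Ico_eq_Ioo hw0 hw1.le]
    · exact hf.integrableOn.mono_set fun t ht => ⟨hw0.trans_le ht.1, ht.2⟩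
    · exact disjoint_left.2 fun t ht ht' => absurd ht.2 (not_lt.2 ht'.1)
  have hhead : ∫ t in Ico w 1, f t ≤ f w := by
    calc ∫ t in Ico w 1, f t ≤ ∫ _ in Ico w 1, f w :=
          setIntegral_mono_on (hf.integrableOn.mono_set fun t ht => ⟨hw0.trans_le ht.1, ht.2⟩)
            (integrableOn_const (by simp)) measurableSet_Ico
            fun t ht => hf.antitoneOn hwI ⟨hw0.trans_le ht.1, ht.2⟩ ht.1
      _ = (1 - w) * f w := by
          rw [setIntegral_const, Real.volume_real_Ico_of_le hw1.le, smul_eq_mul]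
      _ ≤ f w := by nlinarith [hf.nonneg w hwI]
  rw [hwb] at htail
  have h1 : A * ((1 - b) / (2 * A) / (1 - b)) = 1 / 2 := by field_simp
  rw [h1] at htail
  set m := ∫ t in Ioo 0 1, f t
  have hfw : m / 2 ≤ f w := by linarith
  rcases le_total x w with hxw | hxw
  · have := hf.antitoneOn hx hwI hxw
    nlinarith
  · have h2 := hf.monotoneOn hwI hx hxw
    have h3 : x ^ (b + 1) ≤ 1 := Real.rpow_le_one hx.1.le hx.2.le (by linarith)
    have h4 := hf.nonneg x hx
    simp only at h2
    nlinarith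

/-- Mass is sorted by the time it first uses the right branch. What uses it now lands in the cone
and is thereafter bounded below by `c` times its mass; the left part is handled by induction, since
the left branch carries `[leftPreimage α (n + 1), 1/2)` onto `[leftPreimage α n, 1)`. -/
theorem PiecewiseRegular.le_transferLin_pow (hα : 0 ≤ α) (hab : α ≤ b) (hb : b < 1)
    (hA : 4 ≤ A * (1 - b)) {c : ℝ} (hc : ∀ f : ℝ → ℝ, RegularCone b A f →
      ∀ x ∈ Ioo (0 : ℝ) 1, c * ∫ t in Ioo 0 1, f t ≤ f x) (n : ℕ) :
    ∀ f : ℝ → ℝ, PiecewiseRegular α b f → ∀ x ∈ Ioo (0 : ℝ) 1,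
      c * ∫ t in Ico (leftPreimage α n) 1, f t ≤ (transferLin α ^ n) f x := by
  have hA4 : 4 ≤ A := by nlinarith
  induction n with
  | zero =>
    intro f hf x hx
    simpa [leftPreimage] using hf.nonneg x hx
  | succ n ih =>
    intro f hf x hx
    have hr := hf.map_rightPart hα (hα.trans hab) hb.le hA4
    have h1 := ih _ (hf.map_leftPart hα hab) x hx
    have h2 := hc _ (hr.transferLin_pow hα hab hb (by linarith) n) x hx
    rw [integral_transferLin_pow hα n hr.integrableOn, integral_rightPart] at h2
    have hm := leftPreimage_mem hα n
    have hm' := leftPreimage_mem hα (n + 1)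
    have hle := leftPreimage_succ_le_half hα n
    have h3 : ∫ t in Ico (leftPreimage α n) 1, leftPart α f t =
        ∫ t in Ico (leftPreimage α (n + 1)) (1 / 2), f t := by
      rw [← leftBranch_image_Ico hα hm]
      exact setIntegral_leftPart_image hα f measurableSet_Ico
        fun t ht => ⟨hm'.1.trans_le ht.1, ht.2⟩
    have h4 : ∫ t in Ico (leftPreimage α (n + 1)) 1, f t =
        (∫ t in Ico (leftPreimage α (n + 1)) (1 / 2), f t) + ∫ t in Ioo (1 / 2) 1, f t := by
      rw [← integral_Ico_eq_integral_Ioo (x := (1 / 2 : ℝ)), ← setIntegral_union _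
        measurableSet_Ico, Ico_union_Ico_eq_Ico hle (by norm_num)]
      · exact hf.integrableOn.mono_set fun t ht =>
          ⟨hm'.1.trans_le ht.1, ht.2.trans (by norm_num)⟩
      · exact hf.integrableOn.mono_set fun t ht => ⟨by linarith [ht.1], ht.2⟩
      · exact disjoint_left.2 fun t ht ht' => absurd ht.2 (not_lt.2 ht'.1)
    rw [h3] at h1
    rw [h4, pow_succ, Module.End.mul_apply, transferLin_eq, map_add, Pi.add_apply, mul_add]
    exact add_le_add h1 h2

end piecewise

/-! ### Coupling and uniform decay. -/

section coupling

variable {α b A : ℝ}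

theorem setIntegral_const_Ioo (s : ℝ) : ∫ _ in Ioo (0 : ℝ) 1, s = s := by
  rw [setIntegral_const, Real.volume_real_Ioo_of_le zero_le_one]
  simp

/-- Domination by `H` bounds the mass of `F` on `(0, leftPreimage α n)`, and `hmass` makes this at
most half of the total. So `n` iterates are bounded below by `c/2` times the mass of `F`; the extra
iterate allows a quarter of that, namely `c/8`, to be subtracted. -/
theorem PiecewiseRegular.coupling_step (hα : 0 ≤ α) (hab : α ≤ b) (hb : b < 1)
    (hA : 4 ≤ A * (1 - b)) {c : ℝ} (hc0 : 0 ≤ c) (hc : ∀ f : ℝ → ℝ, RegularCone b A f →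
      ∀ x ∈ Ioo (0 : ℝ) 1, c * ∫ t in Ioo 0 1, f t ≤ f x) {n : ℕ} {F H : ℝ → ℝ}
    (hF : PiecewiseRegular α b F) (hH : RegularCone b A H) (hH1 : ∫ t in Ioo 0 1, H t = 1)
    (hFH : ∀ x ∈ Ioo (0 : ℝ) 1, F x ≤ H x)
    (hmass : 2 * A / (1 - b) * (1 / ((n : ℝ) + 1)) ^ (1 - b) ≤ ∫ t in Ioo 0 1, F t) :
    PiecewiseRegular α b
      ((transferLin α ^ (n + 1)) F - fun _ => c / 8 * ∫ t in Ioo 0 1, F t) := by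
  have hm : 0 ≤ ∫ t in Ioo 0 1, F t := setIntegral_nonneg measurableSet_Ioo hF.nonneg
  rw [pow_succ', Module.End.mul_apply]
  refine (hF.transferLin_pow hα hab n).transferLin_sub_const hα hab (by positivity)
    fun x hx => ?_
  refine le_trans ?_ (PiecewiseRegular.le_transferLin_pow hα hab hb hA hc n F hF x hx)
  have hz := leftPreimage_mem hα n
  set z := leftPreimage α n
  have hsplit : ∫ t in Ioo 0 1, F t = (∫ t in Ioo 0 z, F t) + ∫ t in Ico z 1, F t := by
    rcases hz.2.eq_or_lt with h1 | h1
    · rw [h1]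
      simp
    rw [← setIntegral_union _ measurableSet_Ico
      (hF.integrableOn.mono_set (Ioo_subset_Ioo_right hz.2)), Ioo_union_Ico_eq_Ioo hz.1 hz.2]
    · exact hF.integrableOn.mono_set fun t ht => ⟨hz.1.trans_le ht.1, ht.2⟩
    · exact disjoint_left.2 fun t ht ht' => absurd ht.2 (not_lt.2 ht'.1)
  have hsub : Ioo 0 z ⊆ Ioo 0 1 := Ioo_subset_Ioo_right hz.2
  have htail : ∫ t in Ioo 0 z, F t ≤ A * (z ^ (1 - b) / (1 - b)) := by
    have h2 := hH.setIntegral_Ioo_le hb ⟨hz.1.le, hz.2⟩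
    rw [hH1, mul_one] at h2
    exact (setIntegral_mono_on (hF.integrableOn.mono_set hsub) (hH.integrableOn.mono_set hsub)
      measurableSet_Ioo fun t ht => hFH t (hsub ht)).trans h2
  have hzn : z ^ (1 - b) ≤ (1 / ((n : ℝ) + 1)) ^ (1 - b) :=
    Real.rpow_le_rpow hz.1.le (leftPreimage_le hα (by linarith) n) (by linarith)
  have hA0 : 0 ≤ A := by
    by_contra h
    nlinarith
  have h3 : 2 * (A * (z ^ (1 - b) / (1 - b))) ≤
      2 * A / (1 - b) * (1 / ((n : ℝ) + 1)) ^ (1 - b) := by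
    have h4 : 0 ≤ 2 * A / (1 - b) := div_nonneg (by linarith) (by linarith)
    calc 2 * (A * (z ^ (1 - b) / (1 - b))) = 2 * A / (1 - b) * z ^ (1 - b) := by ring
      _ ≤ _ := mul_le_mul_of_nonneg_left hzn h4
  have h5 : (∫ t in Ioo 0 1, F t) / 2 ≤ ∫ t in Ico z 1, F t := by linarith
  nlinarith

/-- Coupling: two densities in the cone can be matched up to a geometrically decreasing
remainder, as long as the remainder is not concentrated near the neutral fixed point. -/
theorem RegularCone.exists_coupling (hα : 0 ≤ α) (hab : α ≤ b) (hb : b < 1)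
    (hA : 4 ≤ A * (1 - b)) {c : ℝ} (hc0 : 0 ≤ c) (hc1 : c ≤ 1)
    (hc : ∀ f : ℝ → ℝ, RegularCone b A f →
      ∀ x ∈ Ioo (0 : ℝ) 1, c * ∫ t in Ioo 0 1, f t ≤ f x)
    {f g : ℝ → ℝ} (hf : RegularCone b A f) (hg : RegularCone b A g)
    (hf1 : ∫ t in Ioo 0 1, f t = 1) (hg1 : ∫ t in Ioo 0 1, g t = 1) (n j : ℕ) :
    ∃ F G : ℝ → ℝ, PiecewiseRegular α b F ∧ PiecewiseRegular α b G ∧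
      (∀ x ∈ Ioo (0 : ℝ) 1, (transferLin α ^ ((n + 1) * j)) (f - g) x = F x - G x) ∧
      (∀ x ∈ Ioo (0 : ℝ) 1, F x ≤ (transferLin α ^ ((n + 1) * j)) f x) ∧
      (∀ x ∈ Ioo (0 : ℝ) 1, G x ≤ (transferLin α ^ ((n + 1) * j)) g x) ∧
      ∫ t in Ioo 0 1, F t = ∫ t in Ioo 0 1, G t ∧
      ∫ t in Ioo 0 1, F t ≤ max ((1 - c / 8) ^ j)
        (2 * A / (1 - b) * (1 / ((n : ℝ) + 1)) ^ (1 - b)) := by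
  induction j with
  | zero =>
    refine ⟨f, g, hf.piecewiseRegular hα, hg.piecewiseRegular hα, by simp, by simp, by simp,
      hf1.trans hg1.symm, by simp [hf1]⟩
  | succ j ih =>
    obtain ⟨F, G, hF, hG, hFG, hFf, hGg, hmass, hle⟩ := ih
    have hpow : ∀ u : ℝ → ℝ, (transferLin α ^ ((n + 1) * (j + 1))) u =
        (transferLin α ^ (n + 1)) ((transferLin α ^ ((n + 1) * j)) u) := by
      intro u
      rw [← Module.End.mul_apply, ← pow_add]
      congr 2
      ring
    have hdiff : ∀ x ∈ Ioo (0 : ℝ) 1, (transferLin α ^ ((n + 1) * (j + 1))) (f - g) x =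
        (transferLin α ^ (n + 1)) F x - (transferLin α ^ (n + 1)) G x := by
      intro x hx
      rw [hpow, ← Pi.sub_apply, ← map_sub]
      exact transferLin_pow_congr hα (n + 1) hFG x hx
    have hupF : ∀ x ∈ Ioo (0 : ℝ) 1, (transferLin α ^ (n + 1)) F x ≤
        (transferLin α ^ ((n + 1) * (j + 1))) f x := by
      rw [hpow]
      exact transferLin_pow_mono hα (n + 1) hFf
    have hupG : ∀ x ∈ Ioo (0 : ℝ) 1, (transferLin α ^ (n + 1)) G x ≤
        (transferLin α ^ ((n + 1) * (j + 1))) g x := by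
      rw [hpow]
      exact transferLin_pow_mono hα (n + 1) hGg
    have hintF := integral_transferLin_pow hα (n + 1) hF.integrableOn
    have hintG := integral_transferLin_pow hα (n + 1) hG.integrableOn
    have hm : 0 ≤ ∫ t in Ioo 0 1, F t := setIntegral_nonneg measurableSet_Ioo hF.nonneg
    -- If the remainder is already below the threshold, it is only transported. Otherwise the same
    -- constant is removed from both sides: it cancels in `F - G`, keeps the masses equal and
    -- preserves domination by the full iterates.
    rcases le_total (∫ t in Ioo 0 1, F t) (2 * A / (1 - b) * (1 / ((n : ℝ) + 1)) ^ (1 - b))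
      with hsmall | hbig
    · exact ⟨_, _, hF.transferLin_pow hα hab (n + 1), hG.transferLin_pow hα hab (n + 1), hdiff,
        hupF, hupG, by rw [hintF, hintG, hmass], by rw [hintF]; exact le_max_of_le_right hsmall⟩
    · have hA3 : 3 ≤ A * (1 - b) := by linarith
      have hstepF := hF.coupling_step hα hab hb hA hc0 hc
        (hf.transferLin_pow hα hab hb hA3 ((n + 1) * j))
        (by rw [integral_transferLin_pow hα _ hf.integrableOn, hf1]) hFf hbig
      have hstepG := hG.coupling_step hα hab hb hA hc0 hc
        (hg.transferLin_pow hα hab hb hA3 ((n + 1) * j))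
        (by rw [integral_transferLin_pow hα _ hg.integrableOn, hg1]) hGg (hmass ▸ hbig)
      rw [← hmass] at hstepG
      set m := ∫ t in Ioo 0 1, F t
      have hs : 0 ≤ c / 8 * m := by positivity
      have hi : ∀ u : ℝ → ℝ, IntegrableOn u (Ioo 0 1) →
          ∫ t in Ioo (0 : ℝ) 1, (u - fun _ : ℝ => c / 8 * m) t =
            (∫ t in Ioo 0 1, u t) - c / 8 * m := by
        intro u hu
        conv_rhs => rw [← setIntegral_const_Ioo (c / 8 * m)]
        exact integral_sub hu (integrableOn_const (by simp))
      have hiF := hi _ (integrableOn_transferLin_pow hα (n + 1) hF.integrableOn)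
      have hiG := hi _ (integrableOn_transferLin_pow hα (n + 1) hG.integrableOn)
      rw [hintF] at hiF
      rw [hintG, ← hmass] at hiG
      refine ⟨_, _, hstepF, hstepG, fun x hx => ?_, fun x hx => ?_, fun x hx => ?_,
        by rw [hiF, hiG], ?_⟩
      · rw [hdiff x hx, Pi.sub_apply, Pi.sub_apply]
        ring
      · have := hupF x hx
        rw [Pi.sub_apply]
        linarith
      · have := hupG x hx
        rw [Pi.sub_apply]
        linarith
      · rw [hiF]
        have h1 : 0 ≤ 1 - c / 8 := by linarith
        rcases le_max_iff.1 hle with h | h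
        · refine le_max_of_le_left ?_
          rw [pow_succ]
          nlinarith
        · exact le_max_of_le_right (by linarith)

theorem RegularCone.integral_abs_transferLin_pow_sub_le (hα : 0 ≤ α) (hab : α ≤ b) (hb : b < 1)
    (hA : 4 ≤ A * (1 - b)) {c : ℝ} (hc0 : 0 ≤ c) (hc1 : c ≤ 1)
    (hc : ∀ f : ℝ → ℝ, RegularCone b A f →
      ∀ x ∈ Ioo (0 : ℝ) 1, c * ∫ t in Ioo 0 1, f t ≤ f x)
    {f g : ℝ → ℝ} (hf : RegularCone b A f) (hg : RegularCone b A g)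
    (hf1 : ∫ t in Ioo 0 1, f t = 1) (hg1 : ∫ t in Ioo 0 1, g t = 1) (n j : ℕ) :
    ∫ x in Ioo 0 1, |(transferLin α ^ ((n + 1) * j)) (f - g) x| ≤
      2 * max ((1 - c / 8) ^ j) (2 * A / (1 - b) * (1 / ((n : ℝ) + 1)) ^ (1 - b)) := by
  obtain ⟨F, G, hF, hG, hFG, -, -, hmass, hle⟩ :=
    hf.exists_coupling hα hab hb hA hc0 hc1 hc hg hf1 hg1 n j
  calc ∫ x in Ioo 0 1, |(transferLin α ^ ((n + 1) * j)) (f - g) x|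
      ≤ ∫ x in Ioo 0 1, (F x + G x) := by
        refine setIntegral_mono_on (integrableOn_transferLin_pow hα _
          (hf.integrableOn.sub hg.integrableOn)).abs (hF.integrableOn.add hG.integrableOn)
          measurableSet_Ioo fun x hx => ?_
        rw [hFG x hx]
        exact (abs_sub _ _).trans (by
          rw [abs_of_nonneg (hF.nonneg x hx), abs_of_nonneg (hG.nonneg x hx)])
    _ = (∫ x in Ioo 0 1, F x) + ∫ x in Ioo 0 1, G x :=
        integral_add hF.integrableOn hG.integrableOn
    _ ≤ _ := by rw [← hmass]; linarith

/-- Decay of correlations for densities in the cone, uniformly in `α ∈ [0, b]`. -/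
theorem RegularCone.exists_decay (hb0 : 0 ≤ b) (hb : b < 1) (hA : 4 ≤ A * (1 - b)) :
    ∃ D : ℝ, 0 < D ∧ ∀ α : ℝ, 0 ≤ α → α ≤ b → ∀ f g : ℝ → ℝ, RegularCone b A f →
      RegularCone b A g → ∫ t in Ioo 0 1, f t = 1 → ∫ t in Ioo 0 1, g t = 1 → ∀ n : ℕ,
      ∫ x in Ioo 0 1, |(transferLin α ^ ((n + 1) * (n + 1))) (f - g) x| ≤
        D * (1 / ((n : ℝ) + 1)) ^ (1 - b) := by
  have hA4 : 4 ≤ A := by nlinarith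
  obtain ⟨c, hc0, hc1, hc⟩ := RegularCone.exists_lower_bound hb0 hb (by linarith : 1 ≤ A)
  refine ⟨2 * (8 / c + 2 * A / (1 - b)), ?_, fun α hα hab f g hf hg hf1 hg1 n => ?_⟩
  · have : 0 ≤ 2 * A / (1 - b) := div_nonneg (by linarith) (by linarith)
    positivity
  refine (hf.integral_abs_transferLin_pow_sub_le hα hab hb hA hc0.le hc1 hc hg hf1 hg1 n
    (n + 1)).trans ?_
  have hn : (0 : ℝ) < (n : ℝ) + 1 := by positivity
  have hr : 0 ≤ (1 / ((n : ℝ) + 1)) ^ (1 - b) := by positivity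
  have hE : 0 ≤ 2 * A / (1 - b) := div_nonneg (by linarith) (by linarith)
  -- By Bernoulli, `(1 - q) ^ N (1 + Nq) ≤ (1 - q²) ^ N ≤ 1`, so the geometric factor is `O(1/N)`
  -- and is absorbed by the tail term.
  have h1 : (1 - c / 8) ^ (n + 1) ≤ 8 / c * (1 / ((n : ℝ) + 1)) ^ (1 - b) := by
    have h2 : (1 - c / 8) ^ (n + 1) * (1 + ((n : ℝ) + 1) * (c / 8)) ≤ 1 := by
      have h3 : 1 + ((n : ℝ) + 1) * (c / 8) ≤ (1 + c / 8) ^ (n + 1) := by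
        have := one_add_mul_le_pow (a := c / 8) (by linarith) (n + 1)
        push_cast at this
        exact this
      have h0 : 0 ≤ (1 - c / 8) ^ (n + 1) := pow_nonneg (by linarith) _
      calc _ ≤ (1 - c / 8) ^ (n + 1) * (1 + c / 8) ^ (n + 1) :=
            mul_le_mul_of_nonneg_left h3 h0
        _ = ((1 - c / 8) * (1 + c / 8)) ^ (n + 1) := (mul_pow _ _ _).symm
        _ ≤ 1 := pow_le_one₀ (by nlinarith) (by nlinarith)
    have h4 : (1 - c / 8) ^ (n + 1) ≤ 8 / c * (1 / ((n : ℝ) + 1)) := by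
      have h0 : 0 ≤ (1 - c / 8) ^ (n + 1) := pow_nonneg (by linarith) _
      rw [div_mul_div_comm, le_div_iff₀ (by positivity)]
      nlinarith
    refine h4.trans (mul_le_mul_of_nonneg_left ?_ (by positivity))
    have h5 := Real.rpow_le_rpow_of_exponent_ge (by positivity : 0 < 1 / ((n : ℝ) + 1))
      (by rw [div_le_one hn]; linarith [(Nat.cast_nonneg n : (0 : ℝ) ≤ n)])
      (by linarith : 1 - b ≤ 1)
    rwa [Real.rpow_one] at h5
  have h6 : max ((1 - c / 8) ^ (n + 1)) (2 * A / (1 - b) * (1 / ((n : ℝ) + 1)) ^ (1 - b)) ≤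
      (8 / c + 2 * A / (1 - b)) * (1 / ((n : ℝ) + 1)) ^ (1 - b) := by
    rw [add_mul]
    have : 0 ≤ 8 / c * (1 / ((n : ℝ) + 1)) ^ (1 - b) := by positivity
    exact max_le (by nlinarith) (by nlinarith)
  linarith

end coupling

/-! ### Dependence of the operator on the parameter. -/

theorem rpow_sub_rpow_le {α γ u : ℝ} (hα : 0 ≤ α) (hu : 0 < u) (hu1 : u ≤ 1)
    (hαγ : α ≤ γ) : u ^ α - u ^ γ ≤ (γ - α) * -Real.log u := by
  have h1 : u ^ γ = u ^ α * u ^ (γ - α) := by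
    rw [← Real.rpow_add hu]
    congr 1
    ring
  have h2 : 1 + (γ - α) * Real.log u ≤ u ^ (γ - α) := by
    rw [Real.rpow_def_of_pos hu, mul_comm]
    linarith [Real.add_one_le_exp (Real.log u * (γ - α))]
  have h3 : u ^ α ≤ 1 := Real.rpow_le_one hu.le hu1 hα
  have h4 : 0 ≤ u ^ α := Real.rpow_nonneg hu.le α
  have h5 : u ^ (γ - α) ≤ 1 := Real.rpow_le_one hu.le hu1 (by linarith)
  rw [h1]
  nlinarith

/-- As `2y ≤ 1`, the power `(2y) ^ α` decreases in `α`: the branch gets lower and its preimages move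
right. -/
theorem leftInv_le_leftInv {α γ x : ℝ} (hα : 0 ≤ α) (hαγ : α ≤ γ) (hx : x ∈ Ioc (0 : ℝ) 1) :
    leftInv α x ≤ leftInv γ x := by
  have hy := leftInv_mem hα hx
  have hw := leftInv_mem (hα.trans hαγ) hx
  by_contra h
  rw [not_le] at h
  have h1 := leftBranch_strictMonoOn hα (mem_Ici.2 hw.1.le) (mem_Ici.2 hy.1.le) h
  rw [leftBranch_leftInv hα hx, ← leftBranch_leftInv (hα.trans hαγ) hx,
    leftInv_leftBranch (hα.trans hαγ) hw, leftBranch_eq hw.1.le, leftBranch_eq hw.1.le] at h1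
  have h2 := Real.rpow_le_rpow_of_exponent_ge (by linarith [hw.1] : 0 < 2 * leftInv γ x)
    (by linarith [hw.2]) hαγ
  have := mul_le_mul_of_nonneg_left h2 hw.1.le
  linarith

/-- Since `h` decreases and the `γ`-preimage `w` is the larger one, replacing `h y` by `h w` is
free. What remains is the difference of derivatives, at most `2(γ - α)(-log (2w))`; the logarithm is
traded for `w ^ (-η) / η`. The bound is written as a `leftPart γ` so that its integral follows by
change of variables. -/
theorem leftPart_sub_leftPart_le {α γ η B b x : ℝ} {h : ℝ → ℝ} (hα : 0 ≤ α) (hαγ : α ≤ γ)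
    (hα1 : α ≤ 1) (hη : 0 < η) (h0 : ∀ x ∈ Ioo (0 : ℝ) 1, 0 ≤ h x)
    (hanti : AntitoneOn h (Ioo 0 1)) (hle : ∀ x ∈ Ioo (0 : ℝ) 1, h x ≤ B * x ^ (-b))
    (hx : x ∈ Ioo (0 : ℝ) 1) :
    leftPart γ h x - leftPart α h x ≤
      leftPart γ (fun y => 2 * (γ - α) * B / η * y ^ (-(b + η))) x := by
  have hγ := hα.trans hαγ
  have hy := leftInv_mem_Ioo hα hx
  have hw := leftInv_mem_Ioo hγ hx
  have hyw := leftInv_le_leftInv hα hαγ (Ioo_subset_Ioc_self hx)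
  simp only [leftPart_apply]
  set y := leftInv α x
  set w := leftInv γ x
  have hh : h w ≤ h y := hanti (Ioo_left_half_subset hy) (Ioo_left_half_subset hw) hyw
  have hw0 := h0 w (Ioo_left_half_subset hw)
  have hwB := hle w (Ioo_left_half_subset hw)
  have hDα := one_le_leftDeriv hα hy.1.le
  have hDγ := one_le_leftDeriv hγ hw.1.le
  have hlog : -Real.log (2 * w) ≤ w ^ (-η) / η := by
    rw [← Real.log_inv]
    refine (Real.log_le_rpow_div (by have := hw.1; positivity) hη).trans ?_
    refine div_le_div_of_nonneg_right ?_ hη.le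
    rw [Real.rpow_neg hw.1.le, ← Real.inv_rpow hw.1.le]
    exact Real.rpow_le_rpow (by have := hw.1; positivity)
      (inv_anti₀ hw.1 (by linarith [hw.1])) hη.le
  have hlog0 : 0 ≤ -Real.log (2 * w) := by
    have := Real.log_nonpos (by linarith [hw.1] : 0 ≤ 2 * w) (by linarith [hw.2])
    linarith
  have hD : leftDeriv α y - leftDeriv γ w ≤ 2 * (γ - α) * (w ^ (-η) / η) := by
    rw [leftDeriv_eq hy.1.le, leftDeriv_eq hw.1.le]
    have h1 := rpow_sub_rpow_le hα (by linarith [hw.1] : 0 < 2 * w) (by linarith [hw.2]) hαγ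
    have h2 : (2 * y) ^ α ≤ (2 * w) ^ α :=
      Real.rpow_le_rpow (by linarith [hy.1]) (by linarith) hα
    have h3 : 0 ≤ (2 * w) ^ γ := Real.rpow_nonneg (by linarith [hw.1]) γ
    have h4 : (γ - α) * -Real.log (2 * w) ≤ (γ - α) * (w ^ (-η) / η) :=
      mul_le_mul_of_nonneg_left hlog (by linarith)
    have h5 : (0 : ℝ) ≤ (γ - α) * (w ^ (-η) / η) :=
      (mul_nonneg (by linarith) hlog0).trans h4
    nlinarith
  have hE : 0 ≤ 2 * (γ - α) * (w ^ (-η) / η) :=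
    mul_nonneg (by linarith) (hlog0.trans hlog)
  calc h w / leftDeriv γ w - h y / leftDeriv α y
      ≤ h w / leftDeriv γ w - h w / leftDeriv α y :=
        sub_le_sub_left (div_le_div_of_nonneg_right hh (by linarith)) _
    _ = h w * (leftDeriv α y - leftDeriv γ w) / leftDeriv α y / leftDeriv γ w := by
        have : leftDeriv α y ≠ 0 := by linarith
        have : leftDeriv γ w ≠ 0 := by linarith
        field_simp
    _ ≤ (2 * (γ - α) * B / η * w ^ (-(b + η))) / leftDeriv γ w := by
        refine div_le_div_of_nonneg_right ?_ (by linarith)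
        rw [div_le_iff₀ (by linarith)]
        calc h w * (leftDeriv α y - leftDeriv γ w)
            ≤ h w * (2 * (γ - α) * (w ^ (-η) / η)) := mul_le_mul_of_nonneg_left hD hw0
          _ ≤ B * w ^ (-b) * (2 * (γ - α) * (w ^ (-η) / η)) :=
              mul_le_mul_of_nonneg_right hwB hE
          _ = 2 * (γ - α) * B / η * w ^ (-(b + η)) := by
              rw [neg_add, Real.rpow_add hw.1]
              ring
          _ ≤ _ := by
              refine le_mul_of_one_le_right ?_ hDα
              have hB : 0 ≤ B * w ^ (-b) := hw0.trans hwB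
              have : 2 * (γ - α) * B / η * w ^ (-(b + η)) =
                  B * w ^ (-b) * (2 * (γ - α) * (w ^ (-η) / η)) := by
                rw [neg_add, Real.rpow_add hw.1]
                ring
              rw [this]
              exact mul_nonneg hB hE

/-- The transfer operator is Lipschitz in the parameter on decreasing functions dominated by
`x ^ (-b)`. -/
theorem integral_abs_transferLin_sub_le {α γ B b : ℝ} {h : ℝ → ℝ} (hα : 0 ≤ α) (hαγ : α ≤ γ)
    (hα1 : α ≤ 1) (hb : b < 1) (hi : IntegrableOn h (Ioo 0 1))
    (h0 : ∀ x ∈ Ioo (0 : ℝ) 1, 0 ≤ h x) (hanti : AntitoneOn h (Ioo 0 1))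
    (hle : ∀ x ∈ Ioo (0 : ℝ) 1, h x ≤ B * x ^ (-b)) :
    ∫ x in Ioo 0 1, |transferLin α h x - transferLin γ h x| ≤
      16 / (1 - b) ^ 2 * B * (γ - α) := by
  have hγ := hα.trans hαγ
  -- Half of the available room, so that `x ^ (-(b + η))` is still integrable.
  set η := (1 - b) / 2 with hηdef
  have hη : 0 < η := by
    rw [hηdef]
    linarith
  have hbη : b + η < 1 := by
    rw [hηdef]
    linarith
  obtain ⟨hWi, hWint⟩ := setIntegral_rpow_neg hbη zero_le_one
  set W : ℝ → ℝ := fun y => 2 * (γ - α) * B / η * y ^ (-(b + η)) with hW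
  have hWi' : IntegrableOn W (Ioo 0 1) := hWi.const_mul _
  have hB : 0 ≤ B := by
    have h1 := (h0 (1 / 2) (by norm_num)).trans (hle (1 / 2) (by norm_num))
    exact nonneg_of_mul_nonneg_left h1 (by positivity)
  have hiα := integrableOn_leftPart hα (hi.mono_set Ioo_left_half_subset)
  have hiγ := integrableOn_leftPart hγ (hi.mono_set Ioo_left_half_subset)
  have hiW := integrableOn_leftPart hγ (hWi'.mono_set Ioo_left_half_subset)
  -- From `u ≤ V` and `V ≥ 0` one gets `|u| ≤ 2V - u`. Here `u` is a difference of two left parts of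
  -- the same `h`, so it has integral zero.
  calc ∫ x in Ioo 0 1, |transferLin α h x - transferLin γ h x|
      ≤ ∫ x in Ioo 0 1, (2 * leftPart γ W x + (leftPart α h x - leftPart γ h x)) := by
        refine setIntegral_mono_on ((integrableOn_transferLin hα hi).sub
          (integrableOn_transferLin hγ hi)).abs ((hiW.const_mul 2).add (hiα.sub hiγ))
          measurableSet_Ioo fun x hx => ?_
        have h1 := leftPart_sub_leftPart_le hα hαγ hα1 hη h0 hanti hle hx
        have h2 : 0 ≤ leftPart γ W x := by
          have hw := leftInv_mem_Ioo hγ hx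
          have h3 := one_le_leftDeriv hγ hw.1.le
          have h4 : 0 ≤ γ - α := by linarith
          have h5 := Real.rpow_nonneg hw.1.le (-(b + η))
          rw [leftPart_apply, hW]
          positivity
        rw [transferLin_apply, transferLin_apply, add_sub_add_right_eq_sub]
        exact abs_le.2 ⟨by linarith, by linarith⟩
    _ = 2 * ∫ x in Ioo 0 (1 / 2), W x := by
        have hsum := integral_add (hiW.const_mul 2) (hiα.sub hiγ)
        simp only [Pi.sub_apply] at hsum
        rw [hsum, integral_sub hiα hiγ, integral_leftPart hα, integral_leftPart hγ, sub_self,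
          add_zero, integral_const_mul, integral_leftPart hγ]
    _ ≤ 2 * ∫ x in Ioo 0 1, W x := by
        refine mul_le_mul_of_nonneg_left (setIntegral_mono_set hWi' ?_
          Ioo_left_half_subset.eventuallyLE) zero_le_two
        refine (ae_restrict_iff' measurableSet_Ioo).2 (ae_of_all _ fun x hx => ?_)
        have h4 : 0 ≤ γ - α := by linarith
        have h5 := Real.rpow_nonneg hx.1.le (-(b + η))
        simp only [hW, Pi.zero_apply]
        positivity
    _ = 16 / (1 - b) ^ 2 * B * (γ - α) := by
        rw [hW, integral_const_mul, hWint, Real.one_rpow, hηdef]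
        have : 1 - b ≠ 0 := by linarith
        have h6 : 1 - (b + (1 - b) / 2) = (1 - b) / 2 := by ring
        rw [h6]
        field_simp
        ring

/-- Telescoping: each new defect `L_α - L_γ` acts on `L_α ^ n h`, which is still in the cone with
the same mass, and the accumulated error is contracted by `L_γ`. -/
theorem RegularCone.integral_abs_transferLin_pow_sub_pow_le {α γ A b : ℝ} {h : ℝ → ℝ}
    (hα : 0 ≤ α) (hαγ : α ≤ γ) (hγb : γ ≤ b) (hb : b < 1) (hA : 3 ≤ A * (1 - b))
    (hh : RegularCone b A h) (n : ℕ) :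
    ∫ x in Ioo 0 1, |(transferLin α ^ n) h x - (transferLin γ ^ n) h x| ≤
      n * (16 / (1 - b) ^ 2 * (A * ∫ t in Ioo 0 1, h t) * (γ - α)) := by
  have hγ := hα.trans hαγ
  induction n with
  | zero => simp
  | succ n ih =>
    have hc := hh.transferLin_pow hα (hαγ.trans hγb) hb hA n
    have h1 := integral_abs_transferLin_sub_le (B := A * ∫ t in Ioo 0 1, h t) hα hαγ
      (by linarith) hb hc.integrableOn hc.nonneg hc.antitoneOn (fun x hx => by
        have := hc.le x hx
        rw [integral_transferLin_pow hα n hh.integrableOn] at this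
        linarith)
    have hiα := integrableOn_transferLin_pow hα n hh.integrableOn
    have hiγ := integrableOn_transferLin_pow hγ n hh.integrableOn
    have h2 := integral_abs_transferLin_le hγ (hiα.sub hiγ)
    rw [pow_succ', pow_succ', Module.End.mul_apply, Module.End.mul_apply]
    have h3 : ∫ x in Ioo 0 1, |transferLin α ((transferLin α ^ n) h) x -
        transferLin γ ((transferLin γ ^ n) h) x| ≤
        ∫ x in Ioo 0 1, (|transferLin α ((transferLin α ^ n) h) x -
          transferLin γ ((transferLin α ^ n) h) x| +
          |transferLin γ ((transferLin α ^ n) h - (transferLin γ ^ n) h) x|) := by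
      have i1 := integrableOn_transferLin hα hiα
      have i2 := integrableOn_transferLin hγ hiα
      have i3 := integrableOn_transferLin hγ hiγ
      refine setIntegral_mono_on (i1.sub i3).abs ((i1.sub i2).abs.add
        (integrableOn_transferLin hγ (hiα.sub hiγ)).abs) measurableSet_Ioo fun x _ => ?_
      rw [map_sub, Pi.sub_apply]
      exact abs_sub_le _ _ _
    have hsum := integral_add
      ((integrableOn_transferLin hα hiα).sub (integrableOn_transferLin hγ hiα)).abs
      (integrableOn_transferLin hγ (hiα.sub hiγ)).abs
    simp only [Pi.sub_apply] at h2 hsum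
    rw [hsum] at h3
    push_cast
    linarith

/-! ### SRB densities as fixed points of the transfer operator. -/

theorem unitLebesgue_eq : unitLebesgue = volume.restrict (Ioo (0 : ℝ) 1) :=
  (Measure.restrict_congr_set Ioo_ae_eq_Icc).symm

theorem measurable_pmMap (α : ℝ) : Measurable (pmMap α) := by
  unfold pmMap
  exact Measurable.ite measurableSet_Iio (by fun_prop) (by fun_prop)

/-- Duality between the map and its transfer operator. -/
theorem setIntegral_transferLin {α : ℝ} (hα : 0 ≤ α) {f : ℝ → ℝ} (hf : IntegrableOn f (Ioo 0 1))
    {s : Set ℝ} (hs : MeasurableSet s) :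
    ∫ x in s, transferLin α f x ∂unitLebesgue = ∫ x in pmMap α ⁻¹' s, f x ∂unitLebesgue := by
  have hs' := measurable_pmMap α hs
  rw [unitLebesgue_eq, ← integral_indicator hs, ← integral_indicator hs',
    ← integral_transferLin hα (Integrable.indicator hf hs')]
  refine setIntegral_congr_fun measurableSet_Ioo fun x hx => ?_
  have hy := leftInv_mem_Ioo hα hx
  have h1 : pmMap α (leftInv α x) = x := by
    rw [pmMap_eq_leftBranch hy.2, leftBranch_leftInv hα (Ioo_subset_Ioc_self hx)]
  have h2 : pmMap α ((x + 1) / 2) = x := by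
    rw [pmMap, if_neg (by linarith [hx.1])]
    ring
  by_cases hxs : x ∈ s
  · rw [indicator_of_mem hxs, transferLin_apply, transferLin_apply, leftPart_apply,
      leftPart_apply, rightPart_apply, rightPart_apply, indicator_of_mem (by simpa [h1] using hxs),
      indicator_of_mem (by simpa [h2] using hxs)]
  · rw [indicator_of_notMem hxs, transferLin_apply, leftPart_apply, rightPart_apply,
      indicator_of_notMem (by simpa [h1] using hxs), indicator_of_notMem (by simpa [h2] using hxs)]
    simp

theorem withDensity_ofReal_apply {h : ℝ → ℝ} (hi : Integrable h unitLebesgue)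
    (h0 : 0 ≤ᵐ[unitLebesgue] h) {s : Set ℝ} (hs : MeasurableSet s) :
    (unitLebesgue.withDensity fun x => ENNReal.ofReal (h x)) s =
      ENNReal.ofReal (∫ x in s, h x ∂unitLebesgue) := by
  rw [withDensity_apply _ hs, ofReal_integral_eq_lintegral_ofReal hi.integrableOn
    (ae_restrict_of_ae h0)]

theorem IsSRBDensity.integrable {α : ℝ} {h : ℝ → ℝ} (hh : IsSRBDensity α h) :
    Integrable h unitLebesgue := by
  rw [← lintegral_ofReal_ne_top_iff_integrable hh.aemeasurable.aestronglyMeasurable hh.nonneg]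
  have h1 := hh.srb.prob.measure_univ
  rw [withDensity_apply _ MeasurableSet.univ, Measure.restrict_univ] at h1
  rw [h1]
  exact ENNReal.one_ne_top

theorem IsSRBDensity.integral_eq_one {α : ℝ} {h : ℝ → ℝ} (hh : IsSRBDensity α h) :
    ∫ x in Ioo 0 1, h x = 1 := by
  have h1 := hh.srb.prob.measure_univ
  rw [withDensity_ofReal_apply hh.integrable hh.nonneg MeasurableSet.univ,
    Measure.restrict_univ, ENNReal.ofReal_eq_one] at h1
  rwa [unitLebesgue_eq] at h1

theorem IsSRBDensity.transferLin_ae_eq {α : ℝ} {h : ℝ → ℝ} (hα : 0 ≤ α)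
    (hh : IsSRBDensity α h) : transferLin α h =ᵐ[unitLebesgue] h := by
  have hi := hh.integrable
  have hi' : IntegrableOn h (Ioo 0 1) := by rwa [unitLebesgue_eq] at hi
  refine Integrable.ae_eq_of_forall_setIntegral_eq _ _ ?_ hi fun s hs _ => ?_
  · rw [unitLebesgue_eq]
    exact integrableOn_transferLin hα hi'
  · rw [setIntegral_transferLin hα hi' hs]
    have h1 := hh.srb.invariant.measure_preimage hs.nullMeasurableSet
    rw [withDensity_ofReal_apply hi hh.nonneg hs,
      withDensity_ofReal_apply hi hh.nonneg (measurable_pmMap α hs)] at h1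
    exact (ENNReal.ofReal_eq_ofReal_iff
      (integral_nonneg_of_ae (ae_restrict_of_ae hh.nonneg))
      (integral_nonneg_of_ae (ae_restrict_of_ae hh.nonneg))).1 h1

/-- The positive lower bound `c` is what makes the invariant measure equivalent to Lebesgue measure,
not merely absolutely continuous. -/
theorem isSRBDensity_of_invariant {α c : ℝ} {h : ℝ → ℝ} (hα : 0 ≤ α) (hc : 0 < c)
    (hi : IntegrableOn h (Ioo 0 1)) (hm : ∫ x in Ioo 0 1, h x = 1)
    (hch : ∀ᵐ x ∂unitLebesgue, c ≤ h x) (hinv : transferLin α h =ᵐ[unitLebesgue] h) :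
    IsSRBDensity α h := by
  have h0 : 0 ≤ᵐ[unitLebesgue] h := hch.mono fun x hx => hc.le.trans hx
  have hi' : Integrable h unitLebesgue := by rwa [unitLebesgue_eq]
  refine ⟨hi'.aemeasurable, h0, ⟨⟨?_⟩, ⟨measurable_pmMap α, ?_⟩,
    withDensity_absolutelyContinuous _ _, withDensity_absolutelyContinuous'
    hi'.aemeasurable.ennreal_ofReal (hch.mono fun x hx => ?_)⟩⟩
  · rw [withDensity_ofReal_apply hi' h0 MeasurableSet.univ, Measure.restrict_univ,
      unitLebesgue_eq, hm, ENNReal.ofReal_one]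
  · ext s hs
    rw [Measure.map_apply (measurable_pmMap α) hs, withDensity_ofReal_apply hi' h0 hs,
      withDensity_ofReal_apply hi' h0 (measurable_pmMap α hs), ← setIntegral_transferLin hα hi hs]
    congr 1
    exact integral_congr_ae (ae_restrict_of_ae hinv)
  · exact (ENNReal.ofReal_pos.2 (hc.trans_le hx)).ne'

/-! ### Convergence to equilibrium. -/

theorem setIntegral_abs_sub_triangle {f g h : ℝ → ℝ} {s : Set ℝ} (hf : IntegrableOn f s)
    (hg : IntegrableOn g s) (hh : IntegrableOn h s) :
    ∫ x in s, |f x - h x| ≤ (∫ x in s, |f x - g x|) + ∫ x in s, |g x - h x| := by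
  have hsum := integral_add (hf.sub hg).abs (hg.sub hh).abs
  simp only [Pi.sub_apply] at hsum
  rw [← hsum]
  exact integral_mono (hf.sub hh).abs ((hf.sub hg).abs.add (hg.sub hh).abs)
    fun x => abs_sub_le _ _ _

theorem integral_abs_transferLin_pow_antitone {α : ℝ} (hα : 0 ≤ α) {f : ℝ → ℝ}
    (hf : IntegrableOn f (Ioo 0 1)) {m n : ℕ} (hmn : m ≤ n) :
    ∫ x in Ioo 0 1, |(transferLin α ^ n) f x| ≤ ∫ x in Ioo 0 1, |(transferLin α ^ m) f x| := by
  obtain ⟨k, rfl⟩ := Nat.exists_eq_add_of_le hmn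
  rw [add_comm, pow_add, Module.End.mul_apply]
  exact integral_abs_transferLin_pow_le hα k (integrableOn_transferLin_pow hα m hf)

theorem regularCone_one {b A : ℝ} (hb0 : 0 ≤ b) (hA : 1 ≤ A) :
    RegularCone b A fun _ => 1 where
  integrableOn := integrableOn_const (by simp)
  nonneg _ _ := zero_le_one
  antitoneOn := antitoneOn_const
  monotoneOn x hx y _ hxy := by
    simpa using Real.rpow_le_rpow hx.1.le hxy (by linarith : 0 ≤ b + 1)
  le x hx := by
    rw [setIntegral_const_Ioo, mul_one]
    have := Real.one_le_rpow_of_pos_of_le_one_of_nonpos hx.1 hx.2.le (by linarith : -b ≤ 0)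
    nlinarith

/-- A Lipschitz function becomes a member of the cone after adding a suitable affine function. -/
theorem regularCone_of_lipschitz {b A K B : ℝ} {f : ℝ → ℝ} (hb0 : 0 ≤ b) (hA : 4 ≤ A)
    (hK : 0 ≤ K) (hfi : IntegrableOn f (Ioo 0 1)) (hfB : ∀ x ∈ Ioo (0 : ℝ) 1, |f x| ≤ B)
    (hfK : ∀ x ∈ Ioo (0 : ℝ) 1, ∀ y ∈ Ioo (0 : ℝ) 1, x ≤ y → |f y - f x| ≤ K * (y - x)) :
    RegularCone b A (fun x => f x + (2 * B + 3 * K + 1 - K * x)) ∧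
      0 < ∫ x in Ioo 0 1, (f x + (2 * B + 3 * K + 1 - K * x)) := by
  have hB : 0 ≤ B := (abs_nonneg _).trans (hfB (1 / 2) (by norm_num))
  have hi : IntegrableOn (fun x => f x + (2 * B + 3 * K + 1 - K * x)) (Ioo 0 1) :=
    hfi.add (((by fun_prop : Continuous fun x : ℝ => 2 * B + 3 * K + 1 - K * x).integrableOn_Icc
      (a := 0) (b := 1)).mono_set Ioo_subset_Icc_self)
  -- The slope `-K` makes the sum decreasing. The value is at least `2K`, which makes `x` times it
  -- increasing, and at least `B + 2K + 1`, while it is at most `3B + 3K + 1`; hence `A ≥ 4`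
  -- suffices for the pointwise bound.
  have hlow : ∀ x ∈ Ioo (0 : ℝ) 1, B + 2 * K + 1 ≤ f x + (2 * B + 3 * K + 1 - K * x) := by
    intro x hx
    have := (abs_le.1 (hfB x hx)).1
    nlinarith [hx.2]
  have hmass : B + 2 * K + 1 ≤ ∫ x in Ioo 0 1, (f x + (2 * B + 3 * K + 1 - K * x)) := by
    conv_lhs => rw [← setIntegral_const_Ioo (B + 2 * K + 1)]
    exact setIntegral_mono_on (integrableOn_const (by simp)) hi measurableSet_Ioo hlow
  refine ⟨⟨hi, fun x hx => ?_, fun x hx y hy hxy => ?_, fun x hx y hy hxy => ?_,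
    fun x hx => ?_⟩, by linarith⟩
  · linarith [hlow x hx]
  · have := (abs_le.1 (hfK x hx y hy hxy)).2
    linarith
  · have h1 := (abs_le.1 (hfK x hx y hy hxy)).1
    have h2 := hlow y hy
    have hxy' : x ^ b ≤ y ^ b := Real.rpow_le_rpow hx.1.le hxy hb0
    have hxb : 0 ≤ x ^ b := Real.rpow_nonneg hx.1.le b
    simp only [Real.rpow_add_one hx.1.ne', Real.rpow_add_one hy.1.ne']
    have h3 : f x + (2 * B + 3 * K + 1 - K * x) ≤
        f y + (2 * B + 3 * K + 1 - K * y) + 2 * K * (y - x) := by linarith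
    set u := f x + (2 * B + 3 * K + 1 - K * x)
    set v := f y + (2 * B + 3 * K + 1 - K * y)
    have h4 : x * u ≤ y * v := by
      have h5 : x * u ≤ x * (v + 2 * K * (y - x)) := mul_le_mul_of_nonneg_left h3 hx.1.le
      have h6 : 0 ≤ (y - x) * (v - 2 * K) := mul_nonneg (by linarith) (by linarith)
      have h7 : 0 ≤ K * (y - x) * (1 - x) :=
        mul_nonneg (mul_nonneg hK (by linarith)) (by linarith [hx.2])
      nlinarith
    have hv : 0 ≤ v := by linarith
    calc x ^ b * x * u = x ^ b * (x * u) := by ring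
      _ ≤ x ^ b * (y * v) := mul_le_mul_of_nonneg_left h4 hxb
      _ ≤ y ^ b * (y * v) := mul_le_mul_of_nonneg_right hxy' (mul_nonneg hy.1.le hv)
      _ = _ := by ring
  · have h1 := (abs_le.1 (hfB x hx)).2
    have h2 := Real.one_le_rpow_of_pos_of_le_one_of_nonpos hx.1 hx.2.le (by linarith : -b ≤ 0)
    have h3 : 4 ≤ A * x ^ (-b) := by nlinarith
    have h4 := mul_nonneg hK hx.1.le
    nlinarith

theorem RegularCone.const_mul {b A c : ℝ} {f : ℝ → ℝ} (hf : RegularCone b A f) (hc : 0 ≤ c) :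
    RegularCone b A (c • f) where
  integrableOn := Integrable.smul c hf.integrableOn
  nonneg x hx := mul_nonneg hc (hf.nonneg x hx)
  antitoneOn x hx y hy hxy := mul_le_mul_of_nonneg_left (hf.antitoneOn hx hy hxy) hc
  monotoneOn x hx y hy hxy := by
    have := mul_le_mul_of_nonneg_left (hf.monotoneOn hx hy hxy) hc
    simp only [Pi.smul_apply, smul_eq_mul] at this ⊢
    linarith
  le x hx := by
    have := mul_le_mul_of_nonneg_left (hf.le x hx) hc
    simp only [Pi.smul_apply, smul_eq_mul, integral_const_mul]
    linarith

section convergence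

variable {α b A : ℝ}

/-- `N` does not depend on `f` and `g`; this uniformity is what later makes the iterates of `1` a
Cauchy sequence. -/
theorem RegularCone.exists_pow_le (hα : 0 ≤ α) (hab : α ≤ b) (hb : b < 1)
    (hA : 4 ≤ A * (1 - b)) {ε : ℝ} (hε : 0 < ε) :
    ∃ N : ℕ, ∀ f g : ℝ → ℝ, RegularCone b A f → RegularCone b A g →
      ∫ t in Ioo 0 1, f t = 1 → ∫ t in Ioo 0 1, g t = 1 → ∀ n ≥ N,
      ∫ x in Ioo 0 1, |(transferLin α ^ n) (f - g) x| ≤ ε := by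
  obtain ⟨D, hD, hdecay⟩ := RegularCone.exists_decay (hα.trans hab) hb hA
  have hlim : Filter.Tendsto (fun n : ℕ => D * (1 / ((n : ℝ) + 1)) ^ (1 - b)) Filter.atTop
      (nhds 0) := by
    have h1 := (tendsto_one_div_add_atTop_nhds_zero_nat (𝕜 := ℝ)).rpow_const
      (p := 1 - b) (Or.inr (by linarith))
    rw [Real.zero_rpow (by linarith)] at h1
    simpa using h1.const_mul D
  obtain ⟨n, hn⟩ := (hlim.eventually (ge_mem_nhds hε)).exists
  exact ⟨(n + 1) * (n + 1), fun f g hf hg hf1 hg1 k hk =>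
    (integral_abs_transferLin_pow_antitone hα (hf.integrableOn.sub hg.integrableOn) hk).trans
      ((hdecay α hα hab f g hf hg hf1 hg1 n).trans hn)⟩

/-- Convergence to equilibrium for members of the cone. -/
theorem RegularCone.exists_pow_sub_integral_le (hα : 0 ≤ α) (hab : α ≤ b) (hb : b < 1)
    (hA : 4 ≤ A * (1 - b)) {f : ℝ → ℝ} (hf : RegularCone b A f)
    (hm : 0 < ∫ t in Ioo 0 1, f t) {ε : ℝ} (hε : 0 < ε) :
    ∃ N : ℕ, ∀ n ≥ N, ∫ x in Ioo 0 1,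
      |(transferLin α ^ n) (f - fun _ => ∫ t in Ioo 0 1, f t) x| ≤ ε := by
  have hA1 : 1 ≤ A := by nlinarith
  set m := ∫ t in Ioo 0 1, f t with hmdef
  obtain ⟨N, hN⟩ := RegularCone.exists_pow_le hα hab hb hA (div_pos hε hm)
  refine ⟨N, fun n hn => ?_⟩
  have h1 := hN (m⁻¹ • f) (fun _ => 1) (hf.const_mul (inv_nonneg.2 hm.le))
    (regularCone_one (hα.trans hab) hA1) (by
      simp only [Pi.smul_apply, smul_eq_mul, integral_const_mul]
      rw [← hmdef, inv_mul_cancel₀ hm.ne']) (setIntegral_const_Ioo 1) n hn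
  have h2 : (f - fun _ => m) = m • (m⁻¹ • f - fun _ => 1) := by
    ext x
    simp only [Pi.sub_apply, Pi.smul_apply, smul_eq_mul]
    field_simp
  rw [h2, map_smul]
  simp only [Pi.smul_apply, smul_eq_mul, abs_mul, abs_of_pos hm, integral_const_mul]
  rwa [le_div_iff₀' hm] at h1

end convergence

theorem Polynomial.exists_bound_lipschitz_Icc (q : Polynomial ℝ) :
    ∃ B K : ℝ, 0 ≤ K ∧ (∀ x ∈ Ioo (0 : ℝ) 1, |q.eval x| ≤ B) ∧
      ∀ x ∈ Ioo (0 : ℝ) 1, ∀ y ∈ Ioo (0 : ℝ) 1, x ≤ y →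
        |q.eval y - q.eval x| ≤ K * (y - x) := by
  obtain ⟨B, hB⟩ := isCompact_Icc.exists_bound_of_continuousOn (s := Icc (0 : ℝ) 1)
    q.continuous.continuousOn
  obtain ⟨K, hK⟩ := isCompact_Icc.exists_bound_of_continuousOn (s := Icc (0 : ℝ) 1)
    q.derivative.continuous.continuousOn
  refine ⟨B, K, (norm_nonneg _).trans (hK 0 (by simp)),
    fun x hx => hB x (Ioo_subset_Icc_self hx), fun x hx y hy hxy => ?_⟩
  have h := (convex_Icc (0 : ℝ) 1).norm_image_sub_le_of_norm_deriv_le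
    (f := fun x => q.eval x) (fun x _ => q.differentiable x)
    (fun x hx => by rw [Polynomial.deriv]; exact hK x hx)
    (Ioo_subset_Icc_self hx) (Ioo_subset_Icc_self hy)
  rwa [Real.norm_eq_abs, Real.norm_eq_abs, abs_of_nonneg (sub_nonneg.2 hxy)] at h

theorem IntegrableOn.exists_polynomial_sub_le {f : ℝ → ℝ} (hf : IntegrableOn f (Ioo 0 1))
    {ε : ℝ} (hε : 0 < ε) :
    ∃ q : Polynomial ℝ, ∫ x in Ioo 0 1, |f x - q.eval x| ≤ ε := by
  obtain ⟨g, hg, hgi⟩ := Integrable.exists_boundedContinuous_integral_sub_le hf (half_pos hε)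
  obtain ⟨q, hq⟩ := exists_polynomial_near_of_continuousOn 0 1 g g.continuous.continuousOn
    (ε / 2) (half_pos hε)
  have hqi : IntegrableOn (fun x => q.eval x) (Ioo 0 1) :=
    (q.continuous.integrableOn_Icc (a := 0) (b := 1)).mono_set Ioo_subset_Icc_self
  refine ⟨q, (setIntegral_abs_sub_triangle hf hgi hqi).trans ?_⟩
  have h1 : ∫ x in Ioo 0 1, |g x - q.eval x| ≤ ε / 2 := by
    conv_rhs => rw [← setIntegral_const_Ioo (ε / 2)]
    refine setIntegral_mono_on (hgi.sub hqi).abs (integrableOn_const (by simp))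
      measurableSet_Ioo fun x hx => ?_
    rw [abs_sub_comm]
    exact (hq x (Ioo_subset_Icc_self hx)).le
  simp only [Real.norm_eq_abs] at hg
  linarith

section convergence

variable {α b A : ℝ}

theorem integral_abs_transferLin_pow_add_le (hα : 0 ≤ α) {f g : ℝ → ℝ}
    (hf : IntegrableOn f (Ioo 0 1)) (hg : IntegrableOn g (Ioo 0 1)) (n : ℕ) :
    ∫ x in Ioo 0 1, |(transferLin α ^ n) (f + g) x| ≤
      (∫ x in Ioo 0 1, |(transferLin α ^ n) f x|) +
        ∫ x in Ioo 0 1, |(transferLin α ^ n) g x| := by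
  have i1 := integrableOn_transferLin_pow hα n hf
  have i2 := integrableOn_transferLin_pow hα n hg
  have hsum := integral_add i1.abs i2.abs
  rw [← hsum, map_add]
  exact integral_mono (i1.add i2).abs (i1.abs.add i2.abs) fun x => abs_add_le _ _

theorem integral_abs_transferLin_pow_sub_le (hα : 0 ≤ α) {f g : ℝ → ℝ}
    (hf : IntegrableOn f (Ioo 0 1)) (hg : IntegrableOn g (Ioo 0 1)) (n : ℕ) :
    ∫ x in Ioo 0 1, |(transferLin α ^ n) (f - g) x| ≤
      (∫ x in Ioo 0 1, |(transferLin α ^ n) f x|) +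
        ∫ x in Ioo 0 1, |(transferLin α ^ n) g x| := by
  have h := integral_abs_transferLin_pow_add_le hα hf hg.neg n
  rw [← sub_eq_add_neg, map_neg] at h
  simpa only [Pi.neg_apply, abs_neg] using h

/-- A polynomial is Lipschitz on `(0, 1)`, hence a difference of two members of the cone: itself
plus an affine function, and that affine function, obtained from `regularCone_of_lipschitz` with `f
= 0` and the same constants. -/
theorem exists_pow_polynomial_sub_integral_le (hα : 0 ≤ α) (hab : α ≤ b) (hb : b < 1)
    (hA : 4 ≤ A * (1 - b)) (q : Polynomial ℝ) {ε : ℝ} (hε : 0 < ε) :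
    ∃ N : ℕ, ∀ n ≥ N, ∫ x in Ioo 0 1, |(transferLin α ^ n)
      ((fun x => q.eval x) - fun _ => ∫ t in Ioo 0 1, q.eval t) x| ≤ ε := by
  have hA4 : 4 ≤ A := by nlinarith
  have hb0 := hα.trans hab
  obtain ⟨B, K, hK, hqB, hqK⟩ := q.exists_bound_lipschitz_Icc
  have hqi : IntegrableOn (fun x => q.eval x) (Ioo 0 1) :=
    (q.continuous.integrableOn_Icc (a := 0) (b := 1)).mono_set Ioo_subset_Icc_self
  have hB : 0 ≤ B := (abs_nonneg _).trans (hqB (1 / 2) (by norm_num))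
  obtain ⟨hF, hF0⟩ := regularCone_of_lipschitz hb0 hA4 hK hqi hqB hqK
  obtain ⟨hG, hG0⟩ := regularCone_of_lipschitz (f := fun _ => 0) hb0 hA4 hK
    (integrableOn_const (by simp)) (fun x _ => by simpa using hB) (fun x _ y _ hxy => by
      simpa using mul_nonneg hK (sub_nonneg.2 hxy))
  obtain ⟨N₁, hN₁⟩ := hF.exists_pow_sub_integral_le hα hab hb hA hF0 (half_pos hε)
  obtain ⟨N₂, hN₂⟩ := hG.exists_pow_sub_integral_le hα hab hb hA hG0 (half_pos hε)
  refine ⟨max N₁ N₂, fun n hn => ?_⟩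
  have h1 := hN₁ n ((le_max_left _ _).trans hn)
  have h2 := hN₂ n ((le_max_right _ _).trans hn)
  have hint : ∫ t in Ioo 0 1, q.eval t =
      (∫ t in Ioo 0 1, (q.eval t + (2 * B + 3 * K + 1 - K * t))) -
        ∫ t in Ioo 0 1, (0 + (2 * B + 3 * K + 1 - K * t)) := by
    rw [← integral_sub hF.integrableOn hG.integrableOn]
    congr 1
    ext t
    ring
  have hci : ∀ c : ℝ, IntegrableOn (fun _ : ℝ => c) (Ioo 0 1) :=
    fun c => integrableOn_const (by simp)
  have h3 := integral_abs_transferLin_pow_sub_le hα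
    (hF.integrableOn.sub (hci (∫ t in Ioo 0 1, (q.eval t + (2 * B + 3 * K + 1 - K * t)))))
    (hG.integrableOn.sub (hci (∫ t in Ioo 0 1, (0 + (2 * B + 3 * K + 1 - K * t))))) n
  have heq : ((fun x => q.eval x) - fun _ => ∫ t in Ioo 0 1, q.eval t) =
      ((fun x => q.eval x + (2 * B + 3 * K + 1 - K * x)) -
        fun _ => ∫ t in Ioo 0 1, (q.eval t + (2 * B + 3 * K + 1 - K * t))) -
      ((fun x => 0 + (2 * B + 3 * K + 1 - K * x)) -
        fun _ => ∫ t in Ioo 0 1, (0 + (2 * B + 3 * K + 1 - K * t))) := by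
    rw [hint]
    ext x
    simp only [Pi.sub_apply]
    ring
  rw [heq]
  exact h3.trans (by linarith)

/-- Convergence to equilibrium in `L¹`. -/
theorem exists_pow_sub_integral_le (hα : 0 ≤ α) (hab : α ≤ b) (hb : b < 1)
    (hA : 4 ≤ A * (1 - b)) {f : ℝ → ℝ} (hf : IntegrableOn f (Ioo 0 1)) {ε : ℝ} (hε : 0 < ε) :
    ∃ N : ℕ, ∀ n ≥ N, ∫ x in Ioo 0 1,
      |(transferLin α ^ n) (f - fun _ => ∫ t in Ioo 0 1, f t) x| ≤ ε := by
  -- One third of `ε` for the polynomial, one for the error `f - q` and one for the mean of that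
  -- error; the operator contracts the last two.
  obtain ⟨q, hq⟩ := IntegrableOn.exists_polynomial_sub_le hf (by positivity : 0 < ε / 3)
  obtain ⟨N, hN⟩ := exists_pow_polynomial_sub_integral_le hα hab hb hA q
    (by positivity : 0 < ε / 3)
  refine ⟨N, fun n hn => ?_⟩
  have hqi : IntegrableOn (fun x => q.eval x) (Ioo 0 1) :=
    (q.continuous.integrableOn_Icc (a := 0) (b := 1)).mono_set Ioo_subset_Icc_self
  have hci : ∀ c : ℝ, IntegrableOn (fun _ : ℝ => c) (Ioo 0 1) :=
    fun c => integrableOn_const (by simp)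
  set u : ℝ → ℝ := f - fun x => q.eval x with hu
  have hui : IntegrableOn u (Ioo 0 1) := hf.sub hqi
  have hint : ∫ t in Ioo 0 1, u t = (∫ t in Ioo 0 1, f t) - ∫ t in Ioo 0 1, q.eval t :=
    integral_sub hf hqi
  have heq : (f - fun _ => ∫ t in Ioo 0 1, f t) =
      ((fun x => q.eval x) - fun _ => ∫ t in Ioo 0 1, q.eval t) +
        (u - fun _ => ∫ t in Ioo 0 1, u t) := by
    rw [hint]
    ext x
    simp only [hu, Pi.sub_apply, Pi.add_apply]
    ring
  have h1 := integral_abs_transferLin_pow_add_le hα (hqi.sub (hci (∫ t in Ioo 0 1, q.eval t)))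
    (hui.sub (hci (∫ t in Ioo 0 1, u t))) n
  have h2 := integral_abs_transferLin_pow_sub_le hα hui (hci (∫ t in Ioo 0 1, u t)) n
  have h3 := integral_abs_transferLin_pow_le hα n hui
  have h4 := integral_abs_transferLin_pow_le hα n (hci (∫ t in Ioo 0 1, u t))
  rw [setIntegral_const_Ioo |∫ t in Ioo 0 1, u t|] at h4
  have h5 : |∫ t in Ioo 0 1, u t| ≤ ∫ t in Ioo 0 1, |u t| := abs_integral_le_integral_abs
  have h6 : ∫ t in Ioo 0 1, |u t| ≤ ε / 3 := hq
  rw [heq]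
  linarith [hN n hn]

/-- `transferLin` acts on functions, not on classes; compatibility with null sets follows from the
`L¹` contraction. -/
theorem transferLin_pow_ae_eq (hα : 0 ≤ α) {f g : ℝ → ℝ} (hf : IntegrableOn f (Ioo 0 1))
    (hg : IntegrableOn g (Ioo 0 1)) (hfg : f =ᵐ[unitLebesgue] g) (n : ℕ) :
    (transferLin α ^ n) f =ᵐ[unitLebesgue] (transferLin α ^ n) g := by
  rw [unitLebesgue_eq] at hfg ⊢
  have hfgi := hf.sub hg
  have h1 := integral_abs_transferLin_pow_le hα n hfgi
  have h2 : ∫ x in Ioo 0 1, |(f - g) x| = 0 := by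
    rw [integral_eq_zero_of_ae]
    filter_upwards [hfg] with x hx
    simp [hx]
  have h3 : ∫ x in Ioo 0 1, |(transferLin α ^ n) (f - g) x| = 0 :=
    le_antisymm (h1.trans h2.le) (integral_nonneg fun _ => abs_nonneg _)
  rw [integral_eq_zero_iff_of_nonneg (fun _ => abs_nonneg _)
    (integrableOn_transferLin_pow hα n hfgi).abs] at h3
  filter_upwards [h3] with x hx
  rw [map_sub] at hx
  simpa [sub_eq_zero] using hx

theorem transferLin_pow_ae_eq_self (hα : 0 ≤ α) {h : ℝ → ℝ} (hi : IntegrableOn h (Ioo 0 1))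
    (hinv : transferLin α h =ᵐ[unitLebesgue] h) (n : ℕ) :
    (transferLin α ^ n) h =ᵐ[unitLebesgue] h := by
  induction n with
  | zero => simp
  | succ n ih =>
    rw [pow_succ, Module.End.mul_apply]
    exact (transferLin_pow_ae_eq hα (integrableOn_transferLin hα hi) hi hinv n).trans ih

/-- The iterates of the constant density converge to every SRB density. -/
theorem IsSRBDensity.exists_pow_one_sub_le {h : ℝ → ℝ} (hh : IsSRBDensity α h) (hα : 0 ≤ α)
    (hab : α ≤ b) (hb : b < 1) (hA : 4 ≤ A * (1 - b)) {ε : ℝ} (hε : 0 < ε) :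
    ∃ N : ℕ, ∀ n ≥ N, ∫ x in Ioo 0 1, |h x - (transferLin α ^ n) (fun _ => 1) x| ≤ ε := by
  have hi : IntegrableOn h (Ioo 0 1) := by
    have := hh.integrable
    rwa [unitLebesgue_eq] at this
  obtain ⟨N, hN⟩ := exists_pow_sub_integral_le hα hab hb hA hi hε
  refine ⟨N, fun n hn => ?_⟩
  have h1 := hN n hn
  rw [hh.integral_eq_one, map_sub] at h1
  refine le_of_eq_of_le (integral_congr_ae ?_) h1
  have h2 := transferLin_pow_ae_eq_self hα hi (hh.transferLin_ae_eq hα) n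
  rw [unitLebesgue_eq] at h2
  filter_upwards [h2] with x hx
  rw [Pi.sub_apply, hx]

/-! ### Existence of the SRB density. -/

/-- The iterates of `1` are Cauchy because `L ^ (N + k) 1 - L ^ N 1 = L ^ N (L ^ k 1 - 1)` with both
functions in the cone. The `L¹` limit inherits mass one, the lower bound `c` and, by contraction,
invariance. -/
theorem exists_isSRBDensity (hα : 0 ≤ α) (hα1 : α < 1) : ∃ h : ℝ → ℝ, IsSRBDensity α h := by
  set A := 4 / (1 - α) with hAdef
  have hα1' : 0 < 1 - α := by linarith
  have hA : 4 ≤ A * (1 - α) := by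
    rw [hAdef, div_mul_cancel₀ _ hα1'.ne']
  have hA1 : 1 ≤ A := by nlinarith
  obtain ⟨c, hc0, -, hc⟩ := RegularCone.exists_lower_bound hα hα1 hA1
  have hcone : ∀ n : ℕ, RegularCone α A ((transferLin α ^ n) fun _ => 1) := fun n =>
    (regularCone_one hα hA1).transferLin_pow hα le_rfl hα1 (by linarith) n
  have hmass : ∀ n : ℕ, ∫ x in Ioo 0 1, (transferLin α ^ n) (fun _ => 1) x = 1 := fun n => by
    rw [integral_transferLin_pow hα n (regularCone_one hα hA1).integrableOn,
      setIntegral_const_Ioo]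
  have hint : ∀ n : ℕ, Integrable ((transferLin α ^ n) fun _ => 1)
      (volume.restrict (Ioo (0 : ℝ) 1)) := fun n => (hcone n).integrableOn
  have hdist : ∀ (n : ℕ) (g : ℝ → ℝ) (hg : Integrable g (volume.restrict (Ioo (0 : ℝ) 1))),
      dist ((hint n).toL1 _) (hg.toL1 g) =
        ∫ x in Ioo 0 1, |(transferLin α ^ n) (fun _ => 1) x - g x| := by
    intro n g hg
    rw [dist_eq_norm, ← Integrable.toL1_sub, L1.norm_of_fun_eq_integral_norm]
    rfl
  have hcauchy : CauchySeq fun n => (hint n).toL1 _ := by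
    refine Metric.cauchySeq_iff'.2 fun ε hε => ?_
    obtain ⟨N, hN⟩ := RegularCone.exists_pow_le hα le_rfl hα1 hA (half_pos hε)
    refine ⟨N, fun n hn => ?_⟩
    obtain ⟨k, rfl⟩ := Nat.exists_eq_add_of_le hn
    rw [hdist]
    have h1 := hN _ _ (hcone k) (hcone 0) (hmass k) (hmass 0) N le_rfl
    rw [map_sub, ← Module.End.mul_apply, ← Module.End.mul_apply, ← pow_add, ← pow_add,
      add_zero] at h1
    simp only [Pi.sub_apply] at h1
    linarith
  obtain ⟨h, hlim⟩ := cauchySeq_tendsto_of_complete hcauchy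
  have hi' : Integrable h (volume.restrict (Ioo (0 : ℝ) 1)) := L1.integrable_coeFn h
  have hi : IntegrableOn h (Ioo 0 1) := hi'
  have hclose : ∀ ε : ℝ, 0 < ε → ∃ N : ℕ, ∀ n ≥ N,
      ∫ x in Ioo 0 1, |(transferLin α ^ n) (fun _ => 1) x - h x| ≤ ε := by
    intro ε hε
    obtain ⟨N, hN⟩ := Metric.tendsto_atTop.1 hlim ε hε
    refine ⟨N, fun n hn => ?_⟩
    have h1 := (hN n hn).le
    rwa [← Integrable.toL1_coeFn h hi', hdist] at h1
  refine ⟨h, isSRBDensity_of_invariant hα hc0 hi ?_ ?_ ?_⟩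
  · refine eq_of_abs_sub_le_all fun ε hε => ?_
    obtain ⟨N, hN⟩ := hclose ε hε
    have h1 := hN N le_rfl
    have h2 := integral_sub hi (hint N)
    rw [hmass N] at h2
    rw [← h2]
    refine abs_integral_le_integral_abs.trans ?_
    simp only [abs_sub_comm (h _)]
    exact h1
  -- As the iterates are at least `c`, the positive part of `c - h` is dominated by their distance
  -- to `h`.
  · have h1 : ∫ x in Ioo 0 1, max (c - h x) 0 = 0 := by
      refine le_antisymm (le_of_forall_pos_le_add fun ε hε => ?_)
        (integral_nonneg fun _ => le_max_right _ _)
      obtain ⟨N, hN⟩ := hclose ε hε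
      refine le_trans ?_ ((hN N le_rfl).trans (by linarith))
      refine setIntegral_mono_on ((integrableOn_const (by simp)).sub hi).pos_part
        ((hint N).sub hi).abs measurableSet_Ioo fun x hx => ?_
      have h2 := hc _ (hcone N) x hx
      rw [hmass, mul_one] at h2
      exact max_le ((by linarith : c - h x ≤ _ - h x).trans (le_abs_self _)) (abs_nonneg _)
    replace h1 := (integral_eq_zero_iff_of_nonneg (fun _ => le_max_right _ _)
      ((integrableOn_const (by simp)).sub hi).pos_part).1 h1
    rw [unitLebesgue_eq]
    filter_upwards [h1] with x hx
    have h3 : max (c - h x) 0 = 0 := hx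
    linarith [max_eq_right_iff.1 h3]
  · have hPi := integrableOn_transferLin hα hi
    have h1 : ∫ x in Ioo 0 1, |transferLin α h x - h x| = 0 := by
      refine le_antisymm (le_of_forall_pos_le_add fun ε hε => ?_)
        (integral_nonneg fun _ => abs_nonneg _)
      obtain ⟨N, hN⟩ := hclose (ε / 2) (half_pos hε)
      have h2 := integral_abs_transferLin_le hα (hi.sub (hint N))
      rw [map_sub, ← Module.End.mul_apply, ← pow_succ'] at h2
      simp only [Pi.sub_apply] at h2
      have h3 := setIntegral_abs_sub_triangle hPi (hint (N + 1)) hi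
      have h4 := hN N le_rfl
      have h5 := hN (N + 1) (Nat.le_succ N)
      simp only [abs_sub_comm (h _)] at h2
      linarith
    replace h1 := (integral_eq_zero_iff_of_nonneg (fun _ => abs_nonneg _) (hPi.sub hi).abs).1 h1
    rw [unitLebesgue_eq]
    filter_upwards [h1] with x hx
    exact sub_eq_zero.1 (abs_eq_zero.1 hx)

end convergence

/-! ### Comparison of SRB densities and the final estimates. -/

/-- Comparison of SRB densities at two parameters. -/
theorem IsSRBDensity.exists_integral_abs_sub_le {b : ℝ} (hb0 : 0 ≤ b) (hb : b < 1) :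
    ∃ C D : ℝ, 0 < C ∧ 0 < D ∧ ∀ α β : ℝ, 0 ≤ α → α ≤ β → β ≤ b → ∀ f g : ℝ → ℝ,
      IsSRBDensity α f → IsSRBDensity β g → ∀ n : ℕ,
      ∫ x in Ioo 0 1, |f x - g x| ≤
        ((n : ℝ) + 1) ^ 2 * (C * (β - α)) + D * (1 / ((n : ℝ) + 1)) ^ (1 - b) := by
  set A := 4 / (1 - b) with hAdef
  have hb1 : 0 < 1 - b := by linarith
  have hA : 4 ≤ A * (1 - b) := by
    rw [hAdef, div_mul_cancel₀ _ hb1.ne']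
  have hA1 : 1 ≤ A := by nlinarith
  obtain ⟨D, hD, hdecay⟩ := RegularCone.exists_decay hb0 hb hA
  refine ⟨16 / (1 - b) ^ 2 * A, D, by positivity, hD,
    fun α β hα hαβ hβb f g hf hg n => le_of_forall_pos_le_add fun ε hε => ?_⟩
  have hβ := hα.trans hαβ
  have hαb := hαβ.trans hβb
  obtain ⟨N₁, hN₁⟩ := hf.exists_pow_one_sub_le hα hαb hb hA (half_pos hε)
  obtain ⟨N₂, hN₂⟩ := hg.exists_pow_one_sub_le hβ hβb hb hA (half_pos hε)
  set M := max N₁ N₂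
  set k := (n + 1) * (n + 1) with hk
  have h1 := hN₁ (k + M) ((le_max_left _ _).trans (Nat.le_add_left _ _))
  have h2 := hN₂ (k + M) ((le_max_right _ _).trans (Nat.le_add_left _ _))
  have hone := regularCone_one hb0 hA1
  have hF := hone.transferLin_pow hα hαb hb (by linarith) M
  have hG := hone.transferLin_pow hβ hβb hb (by linarith) M
  have hF1 : ∫ x in Ioo 0 1, (transferLin α ^ M) (fun _ => 1) x = 1 := by
    rw [integral_transferLin_pow hα M hone.integrableOn, setIntegral_const_Ioo]
  have hG1 : ∫ x in Ioo 0 1, (transferLin β ^ M) (fun _ => 1) x = 1 := by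
    rw [integral_transferLin_pow hβ M hone.integrableOn, setIntegral_const_Ioo]
  rw [pow_add, Module.End.mul_apply] at h1 h2
  set F := (transferLin α ^ M) fun _ => 1
  set G := (transferLin β ^ M) fun _ => 1
  -- Up to `ε`, the two densities are `L_α ^ k F` and `L_β ^ k G`. They are compared through `L_β ^
  -- k F`: `k` steps of parameter error, then decay for `F - G`.
  have h3 := hF.integral_abs_transferLin_pow_sub_pow_le hα hαβ hβb hb (by linarith) k
  have h4 := hdecay β hβ hβb F G hF hG hF1 hG1 n
  rw [← hk, map_sub] at h4
  simp only [Pi.sub_apply] at h4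
  rw [hF1, mul_one] at h3
  have hfi : IntegrableOn f (Ioo 0 1) := by
    have := hf.integrable
    rwa [unitLebesgue_eq] at this
  have hgi : IntegrableOn g (Ioo 0 1) := by
    have := hg.integrable
    rwa [unitLebesgue_eq] at this
  have i1 := integrableOn_transferLin_pow hα k hF.integrableOn
  have i2 := integrableOn_transferLin_pow hβ k hF.integrableOn
  have i3 := integrableOn_transferLin_pow hβ k hG.integrableOn
  have t1 := setIntegral_abs_sub_triangle hfi i1 hgi
  have t2 := setIntegral_abs_sub_triangle i1 i2 hgi
  have t3 := setIntegral_abs_sub_triangle i2 i3 hgi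
  simp only [abs_sub_comm (g _)] at h2
  have hk' : (k : ℝ) = ((n : ℝ) + 1) ^ 2 := by
    rw [hk]
    push_cast
    ring
  rw [hk'] at h3
  linarith

theorem theorem5 (βs : ℝ) (hβs0 : 0 < βs) (hβs1 : βs < 1) :
    (∀ α : ℝ, 0 ≤ α → α ≤ βs → ∃ h : ℝ → ℝ, IsSRBDensity α h) ∧
    ∃ C₂ : ℝ, 0 < C₂ ∧ ∀ α β : ℝ, 0 ≤ α → α < β → β ≤ βs →
      (∀ h : ℝ → ℝ, MemCone βs h →
        Integrable (transferOp α h - transferOp β h) unitLebesgue ∧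
        l1Norm (transferOp α h - transferOp β h) ≤
          C₂ * l1Norm h * (β - α) ^ ((1 / 3 : ℝ) * (1 - βs)) * |Real.log (β - α)|) ∧
      (∀ hα hβ : ℝ → ℝ, IsSRBDensity α hα → IsSRBDensity β hβ →
        l1Norm (hα - hβ) ≤
          C₂ * (β - α) ^ ((1 / 3 : ℝ) * (1 - βs) ^ 2) * |Real.log (β - α)| ^ (1 / βs)) := by
  refine ⟨fun α hα hαβ => exists_isSRBDensity hα (hαβ.trans_lt hβs1), ?_⟩
  obtain ⟨C, D, hC, hD, hCD⟩ := IsSRBDensity.exists_integral_abs_sub_le hβs0.le hβs1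
  set l := -Real.log βs with hl
  have hl0 : 0 < l := by
    have := Real.log_neg hβs0 hβs1
    linarith
  have hb1 : 0 < 1 - βs := by linarith
  set E := 16 / (1 - βs) ^ 2 * (2 ^ βs * (βs + 2)) with hE
  have hE0 : 0 < E := by positivity
  refine ⟨E / l + (4 * C + D) / l ^ (1 / βs), by positivity,
    fun α β hα hαβ hβ => ⟨fun h hh => ?_, fun f g hf hg => ?_⟩⟩
  all_goals
    have hδ0 : 0 < β - α := by linarith
    have hδ1 : β - α ≤ βs := by linarith
    set δ := β - α
    have hlog : l ≤ |Real.log δ| := by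
      have := Real.log_le_log hδ0 hδ1
      exact (by linarith : l ≤ -Real.log δ).trans (neg_le_abs _)
  · have hβ0 : 0 ≤ β := hα.trans hαβ.le
    have hi : IntegrableOn h (Ioo 0 1) := by
      have := hh.integrable
      rwa [unitLebesgue_eq] at this
    have hsub : Ioo (0 : ℝ) 1 ⊆ Ioc 0 1 := Ioo_subset_Ioc_self
    have hint : ∫ x, h x ∂unitLebesgue = l1Norm h := by
      rw [l1Norm, unitLebesgue_eq]
      exact setIntegral_congr_fun measurableSet_Ioo fun x hx =>
        (abs_of_nonneg (hh.nonneg x (hsub hx))).symm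
    have heq : ∀ x ∈ Ioo (0 : ℝ) 1, (transferOp α h - transferOp β h) x =
        (transferLin α h - transferLin β h) x := fun x hx => by
      rw [Pi.sub_apply, Pi.sub_apply, transferOp_eq_transferLin hα h hx,
        transferOp_eq_transferLin hβ0 h hx]
    refine ⟨?_, ?_⟩
    · rw [unitLebesgue_eq]
      exact ((integrableOn_transferLin hα hi).sub (integrableOn_transferLin hβ0 hi)).congr_fun
        (fun x hx => (heq x hx).symm) measurableSet_Ioo
    · have h1 := integral_abs_transferLin_sub_le (B := 2 ^ βs * (βs + 2) * l1Norm h) hα hαβ.le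
        (by linarith) hβs1 hi (fun x hx => hh.nonneg x (hsub hx)) (hh.antitoneOn.mono hsub)
        (fun x hx => by
          have := hh.le x (hsub hx)
          rw [hint] at this
          linarith)
      have h2 : l1Norm (transferOp α h - transferOp β h) ≤ E * l1Norm h * δ := by
        rw [l1Norm, unitLebesgue_eq]
        refine le_of_eq_of_le (setIntegral_congr_fun measurableSet_Ioo fun x hx => ?_)
          (h1.trans_eq (by rw [hE]; ring))
        simp only [heq x hx, Pi.sub_apply]
      have hn : 0 ≤ l1Norm h := integral_nonneg fun _ => abs_nonneg _
      have h3 : δ ≤ δ ^ ((1 / 3 : ℝ) * (1 - βs)) := by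
        have := Real.rpow_le_rpow_of_exponent_ge hδ0 (by linarith : δ ≤ 1)
          (by linarith : (1 / 3 : ℝ) * (1 - βs) ≤ 1)
        rwa [Real.rpow_one] at this
      have h4 : E ≤ (E / l + (4 * C + D) / l ^ (1 / βs)) * |Real.log δ| := by
        calc E = E / l * l := by field_simp
          _ ≤ (E / l + (4 * C + D) / l ^ (1 / βs)) * |Real.log δ| :=
            mul_le_mul (le_add_of_nonneg_right (by positivity)) hlog hl0.le (by positivity)
      calc _ ≤ E * l1Norm h * δ := h2
        _ ≤ ((E / l + (4 * C + D) / l ^ (1 / βs)) * |Real.log δ|) * l1Norm h *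
            δ ^ ((1 / 3 : ℝ) * (1 - βs)) := by gcongr
        _ = _ := by ring
  · have hδ1' : δ ≤ 1 := by linarith
    -- With `n + 1` of order `1/r`, the term `(n+1)² δ` is `O(r)` and the decay term is at most `r ^
    -- (1 - βs)`. Both are below the required `r ^ ((1 - βs) ^ 2)`, since `r ≤ 1` and `(1 - βs)² ≤ 1
    -- - βs ≤ 1`.
    set r := δ ^ (1 / 3 : ℝ) with hr
    have hr0 : 0 < r := Real.rpow_pos_of_pos hδ0 _
    have hr1 : r ≤ 1 := Real.rpow_le_one hδ0.le hδ1' (by norm_num)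
    have hr3 : r ^ 3 = δ := by
      rw [hr, ← Real.rpow_natCast, ← Real.rpow_mul hδ0.le]
      norm_num
    set n := ⌊1 / r⌋₊
    have hn1 : (n : ℝ) ≤ 1 / r := Nat.floor_le (by positivity)
    have hn2 : 1 / r < (n : ℝ) + 1 := Nat.lt_floor_add_one _
    have h1 := hCD α β hα hαβ.le hβ f g hf hg n
    have h2 : ((n : ℝ) + 1) ^ 2 * δ ≤ 4 * r := by
      have h3 : ((n : ℝ) + 1) * r ≤ 2 := by
        have : (n : ℝ) * r ≤ 1 := (le_div_iff₀ hr0).1 hn1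
        linarith
      have h4 : 0 ≤ ((n : ℝ) + 1) * r := by positivity
      rw [← hr3]
      nlinarith [mul_le_mul_of_nonneg_right (pow_le_pow_left₀ h4 h3 2) hr0.le]
    have h5 : 1 / ((n : ℝ) + 1) ≤ r := by
      rw [div_le_iff₀ (by positivity)]
      rw [div_lt_iff₀ hr0] at hn2
      linarith
    have h6 : (1 / ((n : ℝ) + 1)) ^ (1 - βs) ≤ r ^ (1 - βs) :=
      Real.rpow_le_rpow (by positivity) h5 hb1.le
    have hrs : δ ^ ((1 / 3 : ℝ) * (1 - βs) ^ 2) = r ^ ((1 - βs) ^ 2) := by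
      rw [hr, ← Real.rpow_mul hδ0.le]
    have h7 : r ≤ r ^ ((1 - βs) ^ 2) := by
      have := Real.rpow_le_rpow_of_exponent_ge hr0 hr1
        (by nlinarith : (1 - βs) ^ 2 ≤ 1)
      rwa [Real.rpow_one] at this
    have h8 : r ^ (1 - βs) ≤ r ^ ((1 - βs) ^ 2) :=
      Real.rpow_le_rpow_of_exponent_ge hr0 hr1 (by nlinarith)
    have hL : l ^ (1 / βs) ≤ |Real.log δ| ^ (1 / βs) :=
      Real.rpow_le_rpow hl0.le hlog (by positivity)
    have h9 : 4 * C + D ≤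
        (E / l + (4 * C + D) / l ^ (1 / βs)) * |Real.log δ| ^ (1 / βs) := by
      have hlp : 0 < l ^ (1 / βs) := Real.rpow_pos_of_pos hl0 _
      calc 4 * C + D = (4 * C + D) / l ^ (1 / βs) * l ^ (1 / βs) := by field_simp
        _ ≤ _ := mul_le_mul (le_add_of_nonneg_left (by positivity)) hL hlp.le (by positivity)
    rw [hrs, l1Norm, unitLebesgue_eq]
    set R := r ^ ((1 - βs) ^ 2)
    have hR : 0 ≤ R := hr0.le.trans h7
    calc ∫ x in Ioo 0 1, |(f - g) x| ≤ _ := h1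
      _ = C * (((n : ℝ) + 1) ^ 2 * δ) + D * (1 / ((n : ℝ) + 1)) ^ (1 - βs) := by ring
      _ ≤ C * (4 * R) + D * R := by
          refine add_le_add (mul_le_mul_of_nonneg_left ?_ hC.le)
            (mul_le_mul_of_nonneg_left (h6.trans h8) hD.le)
          linarith
      _ = (4 * C + D) * R := by ring
      _ ≤ ((E / l + (4 * C + D) / l ^ (1 / βs)) * |Real.log δ| ^ (1 / βs)) * R :=
          mul_le_mul_of_nonneg_right h9 hR
      _ = _ := by ring
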